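/- Let $n\in\mathbb N$, $\alpha>0$, $m\in\mathbb R$, $T>0$. For $s\in\mathbb R$ let $H^s=H^s(\mathbb R^n)$ be the Sobolev (Bessel potential) space, and let $(-\mathcal L)^{\alpha}:H^m\to H^{m-2\alpha}$ be the Fourier multiplier with symbol $|2\pi\xi|^{2\alpha}$. Consider the Cauchy problem $$\partial_t u(t,x)+a(t)(-\mathcal L)^{\alpha}u(t,x)+b(t)u(t,x)=f(t,x)\quad ((t,x)\in(0,T]\times\mathbb R^n),\qquad u(0,x)=u_0(x).\tag{P}$$ Let $a,b$ be real distributions on $\mathbb R$ and $f$ a distribution on $\mathbb R$ with values in $H^m$, all with support contained in $[0,T]$. Let $a_0>0$ be such that $a\ge a_0$ on $[0,T]$, that is, $\langle a,\varphi\rangle\ge a_0\int_0^T\varphi(t)\,dt$ for all $\varphi\in C_c^\infty(\mathbb R)$ with $\varphi\ge0$. Let $u_0\in H^m$. *Nets.* Nets are indexed by $\varepsilon\in(0,1]$. For $k\in\{0,1\}$, a net $(a_\varepsilon)$ of functions in $L^\infty(\mathbb R)$ with weak derivatives up to order $k$ in $L^\infty(\mathbb R)$ is $L^\infty_k$-moderate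 if for every compact $K\subset\mathbb R$ there are $N\in\mathbb N_0$, $c>0$ with $\|\partial^j a_\varepsilon\|_{L^\infty(K)}\le c\,\varepsilon^{-N-j}$ for all $j\le k$ and all $\varepsilon$; it is $L^\infty_k$-negligible if for every compact $K$ and every $q\in\mathbb N_0$ there is $c>0$ with $\|\partial^j a_\varepsilon\|_{L^\infty(K)}\le c\,\varepsilon^{q}$ for all $j\le k$ and all $\varepsilon$. Write $L^\infty=L^\infty_0$. A net $(v_\varepsilon)$ in $L^2([0,T];H^m)$ is moderate if $\|v_\varepsilon\|_{L^2([0,T];H^m)}\le c\,\varepsilon^{-N}$ for some $N\in\mathbb N_0$, $c>0$ and all $\varepsilon$, and negligible if for every $q\in\mathbb N_0$ there is $c>0$ with $\|v_\varepsilon\|_{L^2([0,T];H^m)}\le c\,\varepsilon^{q}$ for all $\varepsilon$. Call $(a_\varepsilon)$ *uniformly positive* if for some $c>0$ one has $a_\varepsilon\ge c$ a.e. on $[0,T]$ for all $\varepsilon$, and $(b_\varepsilon)$ *log-bounded* if for some $C$ one has $\|b_\varepsilon\|_{L^\infty([0,T])}\le C(1+\log(1/\varepsilon))$ for all $\varepsilon$.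 *Very weak solutions.* A Friedrichs mollifier is a $\psi\in C_c^\infty(\mathbb R)$ with $\psi\ge0$ and $\int\psi=1$; put $\psi_\delta(t)=\delta^{-1}\psi(t/\delta)$. A scale is a function $\omega:(0,1]\to(0,\infty)$ with $\omega(\varepsilon)\to0$ as $\varepsilon\to0$. The regularisation of a distribution $S$ on $\mathbb R$ by $\psi,\omega$ is the net $S_\varepsilon=S*\psi_{\omega(\varepsilon)}$. A solution of (P) with coefficients $a_\varepsilon,b_\varepsilon$, source $f_\varepsilon$ and initial value $u_0$ is a $u\in L^2([0,T];H^m)$ with $u(0)=u_0$ and $u(t)+\int_0^t a_\varepsilon(-\mathcal L)^{\alpha}u\,ds+\int_0^t b_\varepsilon u\,ds=u_0+\int_0^t f_\varepsilon\,ds$ for all $t\in[0,T]$, as an identity of tempered distributions. The net $(u_\varepsilon)$ is a very weak solution of order $m$ of (P) by means of regularisations $(a_\varepsilon),(b_\varepsilon),(f_\varepsilon)$ of $a,b,f$ if these are $L^\infty_1$-, $L^\infty$- and $L^2([0,T];H^m)$-moderate respectively, each $u_\varepsilon$ solves (P) with $a_\varepsilon,b_\varepsilon,f_\varepsilon$ and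 initial value $u_0$, and $(u_\varepsilon)$ is $L^2([0,T];H^m)$-moderate. **Theorem 1.2 (Eucheatwelvws).** The problem (P) has a unique very weak solution of order $m$, in the following sense. 1. (Existence) For every Friedrichs mollifier $\psi$ there is a scale $\omega$ such that (P) has a very weak solution $(u_\varepsilon)$ of order $m$ by means of the regularisations $(a_\varepsilon),(b_\varepsilon),(f_\varepsilon)$ of $a,b,f$ by $\psi,\omega$, with $u_\varepsilon\in C([0,T];H^m)$ for all $\varepsilon$ and with $(b_\varepsilon)$ log-bounded; if moreover $\int_{-\infty}^0\psi>0$ and $\int_0^{\infty}\psi>0$, then $(a_\varepsilon)$ is uniformly positive. 2. (Uniqueness) Let $(a_\varepsilon),(\tilde a_\varepsilon)$ be uniformly positive $L^\infty_1$-moderate nets with $L^\infty_1$-negligible difference, $(b_\varepsilon),(\tilde b_\varepsilon)$ log-bounded $L^\infty$-moderate nets with $L^\infty$-negligible difference, and $(f_\varepsilon),(\tilde f_\varepsilon)$ $L^2([0,T];H^m)$-moderate nets with $L^2([0,T];H^m)$-negligible difference. If, for all $\varepsilon$, $u_\varepsilon$ and $\tilde u_\varepsilon$ solve (P) with $a_\varepsilon,b_\varepsilon,f_\varepsilon$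 and with $\tilde a_\varepsilon,\tilde b_\varepsilon,\tilde f_\varepsilon$, respectively, and with the same initial value $u_0$, then $(u_\varepsilon-\tilde u_\varepsilon)$ is $L^2([0,T];H^m)$-negligible. -/

import Mathlib

open MeasureTheory Set Filter Topology TopologicalSpace
open scoped ENNReal SchwartzMap Distributions FourierTransform

noncomputable section

/-! ### The Sobolev spaces `H^m(ℝⁿ)` -/

/-- `H^m(ℝⁿ)` as a subspace of the tempered distributions: those `u` for which the Bessel potential
of order `m` of `u` is in `L²`. -/
def sobolevSubmodule (n : ℕ) (m : ℝ) : Submodule ℂ 𝓢'(EuclideanSpace ℝ (Fin n), ℂ) where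
  carrier := {u | TemperedDistribution.MemSobolev m 2 u}
  add_mem' hu hv := hu.add hv
  zero_mem' := TemperedDistribution.memSobolev_fun_zero _ _ m 2
  smul_mem' c _ hu := hu.smul c

/-- The Sobolev space `H^m(ℝⁿ)`, `m ∈ ℝ`. It carries the norm `‖u‖ = ‖⟨D⟩^m u‖_{L²}` below. -/
def Sob (n : ℕ) (m : ℝ) : Type := sobolevSubmodule n m

namespace Sob

variable {n : ℕ} {m : ℝ}

instance : AddCommGroup (Sob n m) := inferInstanceAs (AddCommGroup (sobolevSubmodule n m))

instance : Module ℂ (Sob n m) := inferInstanceAs (Module ℂ (sobolevSubmodule n m))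

/-- The inclusion of `H^m(ℝⁿ)` in the tempered distributions. -/
def toDist (n : ℕ) (m : ℝ) : Sob n m →ₗ[ℂ] 𝓢'(EuclideanSpace ℝ (Fin n), ℂ) :=
  (sobolevSubmodule n m).subtype

theorem toDist_injective : Function.Injective (toDist n m) := Subtype.val_injective

theorem memSobolev (u : Sob n m) : TemperedDistribution.MemSobolev m 2 (toDist n m u) := u.2

theorem lp_toDist_injective :
    Function.Injective (Lp.toTemperedDistributionCLM ℂ
      (volume : Measure (EuclideanSpace ℝ (Fin n))) 2) :=
  LinearMap.ker_eq_bot.mp Lp.ker_toTemperedDistributionCLM_eq_bot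

/-- The `L²` function `⟨D⟩^m u` of `u ∈ H^m(ℝⁿ)`. -/
def besselFun (u : Sob n m) : Lp ℂ 2 (volume : Measure (EuclideanSpace ℝ (Fin n))) :=
  (memSobolev u).choose

theorem besselFun_spec (u : Sob n m) :
    TemperedDistribution.besselPotential _ ℂ m (toDist n m u) =
      Lp.toTemperedDistributionCLM ℂ volume 2 (besselFun u) :=
  (memSobolev u).choose_spec

/-- `⟨D⟩^m` as a linear bijection from `H^m(ℝⁿ)` to `L²(ℝⁿ)`. -/
def bessel (n : ℕ) (m : ℝ) :
    Sob n m ≃ₗ[ℂ] Lp ℂ 2 (volume : Measure (EuclideanSpace ℝ (Fin n))) :=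
  LinearEquiv.ofBijective
    { toFun := besselFun
      map_add' := fun u v => lp_toDist_injective (by
        rw [map_add, ← besselFun_spec, ← besselFun_spec, ← besselFun_spec, map_add, map_add])
      map_smul' := fun c u => lp_toDist_injective (by
        rw [RingHom.id_apply, map_smul, ← besselFun_spec, ← besselFun_spec, map_smul, map_smul]) }
    ⟨by
      intro u v h
      have h' : besselFun u = besselFun v := h
      have h2 := besselFun_spec u
      rw [h', ← besselFun_spec v] at h2
      have h3 := congrArg (TemperedDistribution.besselPotential _ ℂ (-m)) h2
      rw [TemperedDistribution.besselPotential_besselPotential_apply,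
        TemperedDistribution.besselPotential_besselPotential_apply] at h3
      simp only [add_neg_cancel, TemperedDistribution.besselPotential_zero] at h3
      exact toDist_injective h3,
    by
      intro g
      have hg : TemperedDistribution.besselPotential _ ℂ m
          (TemperedDistribution.besselPotential _ ℂ (-m)
            (Lp.toTemperedDistributionCLM ℂ
              (volume : Measure (EuclideanSpace ℝ (Fin n))) 2 g)) =
          Lp.toTemperedDistributionCLM ℂ volume 2 g := by
        rw [TemperedDistribution.besselPotential_besselPotential_apply]
        simp
      let u : Sob n m := ⟨_, g, hg⟩
      exact ⟨u, lp_toDist_injective ((besselFun_spec u).symm.trans hg)⟩⟩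

instance : NormedAddCommGroup (Sob n m) :=
  NormedAddCommGroup.induced (Sob n m) (Lp ℂ 2 (volume : Measure (EuclideanSpace ℝ (Fin n))))
    (bessel n m) (bessel n m).injective

instance : NormedSpace ℂ (Sob n m) :=
  NormedSpace.induced ℂ (Sob n m) (Lp ℂ 2 (volume : Measure (EuclideanSpace ℝ (Fin n))))
    (bessel n m)

/-- `⟨D⟩^m` as an isometry from `H^m(ℝⁿ)` onto `L²(ℝⁿ)`. -/
def besselIso (n : ℕ) (m : ℝ) :
    Sob n m ≃ₗᵢ[ℂ] Lp ℂ 2 (volume : Measure (EuclideanSpace ℝ (Fin n))) :=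
  ⟨bessel n m, fun _ => rfl⟩

instance : CompleteSpace (Sob n m) :=
  (besselIso n m).toIsometryEquiv.completeSpace

/-- The isometry `u ↦ (1 + |ξ|²)^(m/2) û(ξ)` from `H^m(ℝⁿ)` onto `L²(ℝⁿ)`. -/
def weightedFourier (n : ℕ) (m : ℝ) :
    Sob n m ≃ₗᵢ[ℂ] Lp ℂ 2 (volume : Measure (EuclideanSpace ℝ (Fin n))) :=
  (besselIso n m).trans (Lp.fourierTransformₗᵢ (EuclideanSpace ℝ (Fin n)) ℂ)

theorem weightedFourier_spec (u : Sob n m) :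
    TemperedDistribution.smulLeftCLM ℂ
        (fun x : EuclideanSpace ℝ (Fin n) => (((1 + ‖x‖ ^ 2) ^ (m / 2) : ℝ) : ℂ))
        (𝓕 (toDist n m u)) =
      Lp.toTemperedDistributionCLM ℂ volume 2 (weightedFourier n m u) := by
  rw [← TemperedDistribution.fourier_besselPotential_eq_smulLeftCLM_fourier_apply, besselFun_spec]
  exact Lp.fourier_toTemperedDistribution_eq _

/-! ### The fractional Laplacian -/

/-- The symbol `|2πξ|^(2α)` of `(-𝓛)^α`, divided by the weight `(1 + |ξ|²)^α`. -/
def fracSymbol (α : ℝ) {n : ℕ} (ξ : EuclideanSpace ℝ (Fin n)) : ℂ :=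
  (((2 * Real.pi * ‖ξ‖) ^ (2 * α) * (1 + ‖ξ‖ ^ 2) ^ (-α) : ℝ) : ℂ)

theorem norm_fracSymbol_le {α : ℝ} (hα : 0 ≤ α) (ξ : EuclideanSpace ℝ (Fin n)) :
    ‖fracSymbol α ξ‖ ≤ (2 * Real.pi) ^ (2 * α) := by
  have hpi := Real.pi_pos
  have h1 : (0 : ℝ) < 1 + ‖ξ‖ ^ 2 := by positivity
  have h2 : ‖ξ‖ ^ (2 * α) ≤ (1 + ‖ξ‖ ^ 2) ^ α := by
    rw [Real.rpow_mul (norm_nonneg _)]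
    apply Real.rpow_le_rpow (by positivity) _ hα
    norm_num
  rw [fracSymbol, Complex.norm_real, Real.norm_eq_abs, abs_of_nonneg (by positivity),
    Real.mul_rpow (by positivity) (norm_nonneg _), mul_assoc, Real.rpow_neg h1.le]
  apply mul_le_of_le_one_right (by positivity)
  rw [← div_eq_mul_inv]
  exact div_le_one_of_le₀ h2 (by positivity)

theorem memLp_fracSymbol_mul {α : ℝ} (hα : 0 ≤ α)
    (g : Lp ℂ 2 (volume : Measure (EuclideanSpace ℝ (Fin n)))) :
    MemLp (fun ξ => fracSymbol α ξ * g ξ) 2 volume := by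
  refine (Lp.memLp g).of_le_mul (c := (2 * Real.pi) ^ (2 * α)) ?_ ?_
  · refine AEStronglyMeasurable.mul ?_ (Lp.memLp g).1
    apply Measurable.aestronglyMeasurable
    unfold fracSymbol
    fun_prop
  · refine Eventually.of_forall fun ξ => ?_
    rw [norm_mul]
    exact mul_le_mul_of_nonneg_right (norm_fracSymbol_le hα ξ) (norm_nonneg _)

/-- The fractional Laplacian `(-𝓛)^α : H^m(ℝⁿ) → H^(m-2α)(ℝⁿ)`, `α ≥ 0`, that is, the Fourier
multiplier with the symbol `|2πξ|^(2α)`: the element of `H^(m-2α)` whose Fourier transform `v̂` has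
`(1 + |ξ|²)^((m-2α)/2) v̂(ξ) = |2πξ|^(2α) (1 + |ξ|²)^(-α) · (1 + |ξ|²)^(m/2) û(ξ)`. -/
def fracLap {α : ℝ} (hα : 0 ≤ α) (u : Sob n m) : Sob n (m - 2 * α) :=
  (weightedFourier n (m - 2 * α)).symm ((memLp_fracSymbol_mul hα (weightedFourier n m u)).toLp)

end Sob

/-! ### Moderate and negligible nets

A net `(a_ε)_{ε ∈ (0,1]}` is a function of `ε : ℝ`, of which only the values at `ε ∈ (0,1]` are
used. -/

/-- `g` is the weak derivative of order `k` of `a` on `ℝ`. -/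
def IsWeakDeriv (k : ℕ) (a g : ℝ → ℝ) : Prop :=
  LocallyIntegrable a ∧ LocallyIntegrable g ∧
    ∀ φ : ℝ → ℝ, ContDiff ℝ (⊤ : ℕ∞) φ → HasCompactSupport φ →
      ∫ t, a t * iteratedDeriv k φ t = (-1) ^ k * ∫ t, g t * φ t

/-- `D k ε`, `k ≤ m`, are the weak derivatives of the net `(a_ε)`, all of them in `L^∞(ℝ)`:
this says `(a_ε) ∈ L^∞_m(ℝ)^{(0,1]}`. -/
def IsLinfDerivs (m : ℕ) (a : ℝ → ℝ → ℝ) (D : ℕ → ℝ → ℝ → ℝ) : Prop :=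
  ∀ ε ∈ Ioc (0 : ℝ) 1, ∀ k ≤ m, MemLp (D k ε) ⊤ volume ∧ IsWeakDeriv k (a ε) (D k ε)

/-- `L^∞_m`-moderate nets. -/
def LinfModerate (m : ℕ) (a : ℝ → ℝ → ℝ) : Prop :=
  ∃ D : ℕ → ℝ → ℝ → ℝ, IsLinfDerivs m a D ∧
    ∀ K : Set ℝ, IsCompact K → ∃ N : ℕ, ∃ c > (0 : ℝ), ∀ ε ∈ Ioc (0 : ℝ) 1, ∀ k ≤ m,
      ∀ᵐ t ∂volume.restrict K, |D k ε t| ≤ c * (ε ^ (N + k))⁻¹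

/-- `L^∞_m`-negligible nets. -/
def LinfNegligible (m : ℕ) (a : ℝ → ℝ → ℝ) : Prop :=
  ∃ D : ℕ → ℝ → ℝ → ℝ, IsLinfDerivs m a D ∧
    ∀ K : Set ℝ, IsCompact K → ∀ q : ℕ, ∃ c > (0 : ℝ), ∀ ε ∈ Ioc (0 : ℝ) 1, ∀ k ≤ m,
      ∀ᵐ t ∂volume.restrict K, |D k ε t| ≤ c * ε ^ q

/-- `L²([0,T]; F)`-moderate nets. -/
def L2Moderate {F : Type*} [NormedAddCommGroup F] (T : ℝ) (u : ℝ → ℝ → F) : Prop :=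
  (∀ ε ∈ Ioc (0 : ℝ) 1, MemLp (u ε) 2 (volume.restrict (Icc 0 T))) ∧
    ∃ N : ℕ, ∃ c > (0 : ℝ), ∀ ε ∈ Ioc (0 : ℝ) 1,
      eLpNorm (u ε) 2 (volume.restrict (Icc 0 T)) ≤ ENNReal.ofReal (c * (ε ^ N)⁻¹)

/-- `L²([0,T]; F)`-negligible nets. -/
def L2Negligible {F : Type*} [NormedAddCommGroup F] (T : ℝ) (u : ℝ → ℝ → F) : Prop :=
  (∀ ε ∈ Ioc (0 : ℝ) 1, MemLp (u ε) 2 (volume.restrict (Icc 0 T))) ∧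
    ∀ q : ℕ, ∃ c > (0 : ℝ), ∀ ε ∈ Ioc (0 : ℝ) 1,
      eLpNorm (u ε) 2 (volume.restrict (Icc 0 T)) ≤ ENNReal.ofReal (c * ε ^ q)

/-- There is a constant `c > 0` with `a_ε ≥ c` almost everywhere on `[0,T]` for all `ε`. -/
def UniformlyPositive (T : ℝ) (a : ℝ → ℝ → ℝ) : Prop :=
  ∃ c > (0 : ℝ), ∀ ε ∈ Ioc (0 : ℝ) 1, ∀ᵐ t ∂volume.restrict (Icc 0 T), c ≤ a ε t

/-- `‖b_ε‖_{L^∞([0,T])} ≤ C (1 + log (1/ε))` for all `ε`. -/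
def LogBounded (T : ℝ) (b : ℝ → ℝ → ℝ) : Prop :=
  ∃ C : ℝ, ∀ ε ∈ Ioc (0 : ℝ) 1, ∀ᵐ t ∂volume.restrict (Icc 0 T),
    |b ε t| ≤ C * (1 + Real.log (1 / ε))

/-! ### Regularisation of distributions -/

/-- A Friedrichs mollifier: a nonnegative test function of integral one. -/
def IsMollifier (ψ : 𝓓((⊤ : Opens ℝ), ℝ)) : Prop :=
  (∀ t, 0 ≤ ψ t) ∧ ∫ t, ψ t = 1

/-- A scale of regularisation: `ω(ε) > 0` and `ω(ε) → 0` as `ε → 0`. -/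
def IsScale (ω : ℝ → ℝ) : Prop :=
  (∀ ε ∈ Ioc (0 : ℝ) 1, 0 < ω ε) ∧ Tendsto ω (𝓝[>] 0) (𝓝 0)

/-- The test function `s ↦ ψ_δ(t - s) = δ⁻¹ ψ((t - s) / δ)` (zero for `δ = 0`). -/
def mollTest (ψ : 𝓓((⊤ : Opens ℝ), ℝ)) (δ t : ℝ) : 𝓓((⊤ : Opens ℝ), ℝ) where
  toFun s := δ⁻¹ * ψ ((t - s) / δ)
  contDiff' := by
    have h := ψ.contDiff
    exact contDiff_const.mul (h.comp (by fun_prop))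
  hasCompactSupport' := by
    rcases eq_or_ne δ 0 with rfl | hδ
    · simpa [Pi.zero_def] using (HasCompactSupport.zero : HasCompactSupport (0 : ℝ → ℝ))
    · have h := ψ.hasCompactSupport.comp_homeomorph
        ((Homeomorph.subLeft t).trans (Homeomorph.mulRight₀ δ⁻¹ (inv_ne_zero hδ)))
      refine HasCompactSupport.mul_left (f := fun _ => δ⁻¹) ?_
      simpa [Function.comp_def, div_eq_mul_inv] using h
  tsupport_subset' := by simp

/-- The regularised net `(S * ψ_{ω(ε)})(t) = ⟨S, ψ_{ω(ε)}(t - ·)⟩` of a distribution `S` on `ℝ`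
with values in `F`. -/
def regularise {F : Type*} [NormedAddCommGroup F] [NormedSpace ℝ F]
    (S : 𝓓'((⊤ : Opens ℝ), F)) (ψ : 𝓓((⊤ : Opens ℝ), ℝ)) (ω : ℝ → ℝ) : ℝ → ℝ → F :=
  fun ε t => S (mollTest ψ (ω ε) t)

/-! ### The Cauchy problem -/

/-- `u ∈ L²([0,T]; H^m)` solves `∂ₜu + a(t)(-𝓛)^α u + b(t)u = f` on `(0,T]`, `u(0) = u₀`. The
equation is integrated in time; the integral of `a (-𝓛)^α u` is taken in `H^(m-2α)`, the other ones
in `H^m`, and the identity holds between tempered distributions on `ℝⁿ`. -/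
structure IsSolution {n : ℕ} {m α : ℝ} (hα : 0 ≤ α) (T : ℝ) (u₀ : Sob n m) (a b : ℝ → ℝ)
    (f u : ℝ → Sob n m) : Prop where
  memLp : MemLp u 2 (volume.restrict (Icc 0 T))
  initial : u 0 = u₀
  equation : ∀ t ∈ Icc 0 T,
    Sob.toDist n m (u t)
        + Sob.toDist n (m - 2 * α) (∫ s in (0 : ℝ)..t, a s • Sob.fracLap hα (u s))
        + Sob.toDist n m (∫ s in (0 : ℝ)..t, b s • u s) =
      Sob.toDist n m u₀ + Sob.toDist n m (∫ s in (0 : ℝ)..t, f s)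

/-- `(u_ε)` is a very weak solution of order `m` by means of the regularising nets `(a_ε)`, `(b_ε)`,
`(f_ε)`: these are moderate, `u_ε` solves the Cauchy problem with `a_ε`, `b_ε`, `f_ε`, and `(u_ε)` is
moderate. -/
structure IsVeryWeakSolution {n : ℕ} {m α : ℝ} (hα : 0 ≤ α) (T : ℝ) (u₀ : Sob n m)
    (a b : ℝ → ℝ → ℝ) (f u : ℝ → ℝ → Sob n m) : Prop where
  moderate_a : LinfModerate 1 a
  moderate_b : LinfModerate 0 b
  moderate_f : L2Moderate T f
  solves : ∀ ε ∈ Ioc (0 : ℝ) 1, IsSolution hα T u₀ (a ε) (b ε) (f ε) (u ε)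
  moderate_u : L2Moderate T u

/-- Uniqueness of the very weak solution: negligible changes of the nets of coefficients and of the
net of source terms change the solutions by a negligible net. -/
def VeryWeakUnique {n : ℕ} {m α : ℝ} (hα : 0 ≤ α) (T : ℝ) (u₀ : Sob n m) : Prop :=
  ∀ (a a' b b' : ℝ → ℝ → ℝ) (f f' u u' : ℝ → ℝ → Sob n m),
    LinfModerate 1 a → LinfModerate 1 a' → LinfNegligible 1 (fun ε t => a ε t - a' ε t) →
    UniformlyPositive T a → UniformlyPositive T a' →
    LinfModerate 0 b → LinfModerate 0 b' → LinfNegligible 0 (fun ε t => b ε t - b' ε t) →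
    LogBounded T b → LogBounded T b' →
    L2Moderate T f → L2Moderate T f' → L2Negligible T (fun ε t => f ε t - f' ε t) →
    (∀ ε ∈ Ioc (0 : ℝ) 1, IsSolution hα T u₀ (a ε) (b ε) (f ε) (u ε)) →
    (∀ ε ∈ Ioc (0 : ℝ) 1, IsSolution hα T u₀ (a' ε) (b' ε) (f' ε) (u' ε)) →
    L2Negligible T (fun ε t => u ε t - u' ε t)

end

/-! Existence is a matter of choosing the scale. For a fixed width `δ`, the mollified coefficients
and source are Lipschitz with compact support, and the mollified `a` is nonnegative, so Duhamel's
formula with the semigroup `exp (-τ (-𝓛)^α)` at time `τ = ∫ a` gives a continuous solution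
(`isSolution_duhamel`). Along a sequence of widths `δ k → 0` every quantity that has to be moderate,
the norm of the solution included, is a finite number depending on `k`. If `k = κ ε` tends to
infinity slowly enough, all these numbers are at most a constant times `1 + log (1/ε)`
(`exists_slow_index`). Hence no a priori estimate is needed here. Uniform positivity holds because,
for small widths, each point of `[0,T]` sees at least one half of the mollifier inside `[0,T]`
(`min_le_integral_mollTest`).

Uniqueness is an energy estimate. The difference `w = u - v` of two solutions satisfies `w' + aΛw +
bw = (f - f') - (b - b')v - Λ((a - a')v)` with `Λ = (-𝓛)^α`. The last term loses `2α` derivatives,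
so the equation is paired not with `w` but with `Mw`, `M = (1 + Λ)⁻¹`. Since `MΛ = 1 - M` is
bounded, this term becomes harmless, while `⟨Λw, Mw⟩ = ‖w‖² - ⟨w, Mw⟩` still yields the full `H^m`
norm of `w`, integrated in time. Gronwall's inequality then bounds `w` in `L²([0,T]; H^m)`
(`energy_estimate`). For log-bounded `b` the Gronwall factor is only a power of `1/ε`, and a
negligible net absorbs it.

Both halves are made rigorous by cutting frequencies off at radius `k`: `Λ` becomes bounded, the
equation becomes an integral equation in `H^m` (`equation_iff`), and the energy constants do not
depend on `k`. -/

noncomputable section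

/-! ### Multiplication operators on `L²` -/

section MulOp

variable {X : Type*} [MeasurableSpace X] {μ : Measure X} {σ τ : X → ℝ}

/-- Bounded measurable real functions. -/
def BddMeas (σ : X → ℝ) : Prop := Measurable σ ∧ ∃ C, ∀ x, |σ x| ≤ C

namespace BddMeas

theorem const (c : ℝ) : BddMeas (fun _ : X => c) := ⟨measurable_const, |c|, fun _ => le_rfl⟩

theorem mul (hσ : BddMeas σ) (hτ : BddMeas τ) : BddMeas (fun x => σ x * τ x) := by
  obtain ⟨hσ, C, hC⟩ := hσ
  obtain ⟨hτ, D, hD⟩ := hτ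
  refine ⟨hσ.mul hτ, C * D, fun x => ?_⟩
  rw [abs_mul]
  exact mul_le_mul (hC x) (hD x) (abs_nonneg _) ((abs_nonneg _).trans (hC x))

theorem add (hσ : BddMeas σ) (hτ : BddMeas τ) : BddMeas (fun x => σ x + τ x) := by
  obtain ⟨hσ, C, hC⟩ := hσ
  obtain ⟨hτ, D, hD⟩ := hτ
  exact ⟨hσ.add hτ, C + D, fun x => (abs_add_le _ _).trans (add_le_add (hC x) (hD x))⟩

theorem neg (hσ : BddMeas σ) : BddMeas (fun x => -σ x) :=
  ⟨hσ.1.neg, hσ.2.imp fun C hC x => by simpa using hC x⟩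

theorem sub (hσ : BddMeas σ) (hτ : BddMeas τ) : BddMeas (fun x => σ x - τ x) := by
  simpa [sub_eq_add_neg] using hσ.add hτ.neg

theorem memLp_mul (hσ : BddMeas σ) (g : Lp ℂ 2 μ) : MemLp (fun x => (σ x : ℂ) * g x) 2 μ := by
  obtain ⟨hσ, C, hC⟩ := hσ
  refine (Lp.memLp g).of_le_mul (c := C) ?_ (Eventually.of_forall fun x => ?_)
  · exact (Complex.measurable_ofReal.comp hσ).aestronglyMeasurable.mul (Lp.memLp g).1
  · rw [norm_mul, Complex.norm_real]
    exact mul_le_mul_of_nonneg_right (hC x) (norm_nonneg _)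

theorem norm_toLp_le (hσ : BddMeas σ) {C : ℝ} (hC : ∀ x, |σ x| ≤ C) (g : Lp ℂ 2 μ) :
    ‖(hσ.memLp_mul g).toLp‖ ≤ C * ‖g‖ := by
  refine Lp.norm_le_mul_norm_of_ae_le_mul ?_
  filter_upwards [(hσ.memLp_mul g).coeFn_toLp] with x hx
  rw [hx, norm_mul, Complex.norm_real]
  exact mul_le_mul_of_nonneg_right (hC x) (norm_nonneg _)

end BddMeas

open Classical in
/-- Multiplication by a bounded measurable real function on `L²` (zero for other functions). -/
def mulOp (μ : Measure X) (σ : X → ℝ) : Lp ℂ 2 μ →L[ℂ] Lp ℂ 2 μ :=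
  if h : BddMeas σ then
    LinearMap.mkContinuousOfExistsBound
      { toFun := fun g => (h.memLp_mul g).toLp
        map_add' := fun f g => by
          rw [← MemLp.toLp_add]
          refine MemLp.toLp_congr _ _ ?_
          filter_upwards [Lp.coeFn_add f g] with x hx
          rw [hx, Pi.add_apply, Pi.add_apply, mul_add]
        map_smul' := fun c g => by
          rw [RingHom.id_apply, ← MemLp.toLp_const_smul]
          refine MemLp.toLp_congr _ _ ?_
          filter_upwards [Lp.coeFn_smul c g] with x hx
          rw [hx, Pi.smul_apply, Pi.smul_apply, smul_eq_mul, smul_eq_mul]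
          ring }
      (h.2.imp fun _ hC g => h.norm_toLp_le hC g)
  else 0

theorem coeFn_mulOp (h : BddMeas σ) (g : Lp ℂ 2 μ) :
    mulOp μ σ g =ᵐ[μ] fun x => (σ x : ℂ) * g x := by
  rw [mulOp, dif_pos h]
  exact (h.memLp_mul g).coeFn_toLp

theorem norm_mulOp_apply_le {C : ℝ} (hm : Measurable σ) (hC : ∀ x, |σ x| ≤ C) (g : Lp ℂ 2 μ) :
    ‖mulOp μ σ g‖ ≤ C * ‖g‖ := by
  rw [mulOp, dif_pos ⟨hm, C, hC⟩]
  exact BddMeas.norm_toLp_le ⟨hm, C, hC⟩ hC g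

theorem mulOp_mulOp (hσ : BddMeas σ) (hτ : BddMeas τ) (g : Lp ℂ 2 μ) :
    mulOp μ σ (mulOp μ τ g) = mulOp μ (fun x => σ x * τ x) g := by
  refine Lp.ext ?_
  filter_upwards [coeFn_mulOp hσ (mulOp μ τ g), coeFn_mulOp hτ g, coeFn_mulOp (hσ.mul hτ) g]
    with x h1 h2 h3
  rw [h1, h2, h3]
  push_cast
  ring

theorem mulOp_add_apply (hσ : BddMeas σ) (hτ : BddMeas τ) (g : Lp ℂ 2 μ) :
    mulOp μ (fun x => σ x + τ x) g = mulOp μ σ g + mulOp μ τ g := by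
  refine Lp.ext ?_
  filter_upwards [coeFn_mulOp hσ g, coeFn_mulOp hτ g, coeFn_mulOp (hσ.add hτ) g,
    Lp.coeFn_add (mulOp μ σ g) (mulOp μ τ g)] with x h1 h2 h3 h4
  rw [h4, h3, Pi.add_apply, h1, h2]
  push_cast
  ring

theorem mulOp_const_apply (c : ℝ) (g : Lp ℂ 2 μ) :
    mulOp μ (fun _ => c) g = (c : ℂ) • g := by
  refine Lp.ext ?_
  filter_upwards [coeFn_mulOp (BddMeas.const c) g, Lp.coeFn_smul (c : ℂ) g] with x h1 h2
  rw [h1, h2, Pi.smul_apply, smul_eq_mul]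

theorem inner_mulOp_left (hσ : BddMeas σ) (f g : Lp ℂ 2 μ) :
    inner ℂ (mulOp μ σ f) g = inner ℂ f (mulOp μ σ g) := by
  rw [L2.inner_def, L2.inner_def]
  refine integral_congr_ae ?_
  filter_upwards [coeFn_mulOp hσ f, coeFn_mulOp hσ g] with x h1 h2
  rw [h1, h2]
  simp only [RCLike.inner_apply, map_mul, Complex.conj_ofReal]
  ring

/-- Dominated convergence for multiplication operators. -/
theorem tendsto_mulOp_apply {ι : Type*} {l : Filter ι} [l.IsCountablyGenerated] {σ' : ι → X → ℝ}
    {C : ℝ} (hm : ∀ᶠ i in l, Measurable (σ' i)) (hC : ∀ᶠ i in l, ∀ x, |σ' i x| ≤ C)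
    (hσ : BddMeas σ) (hlim : ∀ x, Tendsto (fun i => σ' i x) l (𝓝 (σ x))) (g : Lp ℂ 2 μ) :
    Tendsto (fun i => mulOp μ (σ' i) g) l (𝓝 (mulOp μ σ g)) := by
  obtain ⟨hσm, D, hD⟩ := id hσ
  rw [Lp.tendsto_Lp_iff_tendsto_eLpNorm']
  have key : Tendsto (fun i => ∫⁻ x, ‖((σ' i x - σ x : ℝ) : ℂ) * g x‖ₑ ^ (2 : ℝ) ∂μ) l (𝓝 0) := by
    have hgm : Measurable fun x => g x := (Lp.stronglyMeasurable g).measurable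
    have h0 : (∫⁻ _ : X, 0 ∂μ) = 0 := lintegral_zero
    rw [← h0]
    refine tendsto_lintegral_filter_of_dominated_convergence
      (fun x => ‖((C + D : ℝ) : ℂ) * g x‖ₑ ^ (2 : ℝ)) ?_ ?_ ?_ (Eventually.of_forall fun x => ?_)
    · filter_upwards [hm] with i hi
      have := hi.sub hσm
      fun_prop
    · filter_upwards [hC] with i hi
      refine Eventually.of_forall fun x => ?_
      gcongr
      rw [← enorm_norm, ← enorm_norm (((C + D : ℝ) : ℂ) * g x)]
      rw [norm_mul, norm_mul, Complex.norm_real, Complex.norm_real]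
      rw [Real.enorm_of_nonneg (by positivity), Real.enorm_of_nonneg (by positivity)]
      apply ENNReal.ofReal_le_ofReal
      gcongr
      exact (abs_sub _ _).trans ((add_le_add (hi x) (hD x)).trans (le_abs_self _))
    · have := ((Lp.memLp g).const_mul ((C + D : ℝ) : ℂ)).2
      have h2 := lintegral_rpow_enorm_lt_top_of_eLpNorm_lt_top (by norm_num) (by norm_num) this
      simpa using h2.ne
    · have h1 : Tendsto (fun i => ((σ' i x - σ x : ℝ) : ℂ) * g x) l (𝓝 (((0 : ℝ) : ℂ) * g x)) := by
        refine Tendsto.mul_const _ ((Complex.continuous_ofReal.tendsto _).comp ?_)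
        simpa using (hlim x).sub_const (σ x)
      have h2 := ((ENNReal.continuous_rpow_const (y := (2 : ℝ))).tendsto _).comp
        ((continuous_enorm.tendsto _).comp h1)
      simpa [Function.comp_def] using h2
  have key2 := ((ENNReal.continuous_rpow_const (y := (1 / 2 : ℝ))).tendsto _).comp key
  have h0 : (0 : ℝ≥0∞) ^ (1 / 2 : ℝ) = 0 := by simp
  rw [h0] at key2
  refine key2.congr' ?_
  filter_upwards [hm, hC] with i hi hi'
  rw [eLpNorm_eq_lintegral_rpow_enorm_toReal (by norm_num) (by norm_num)]
  simp only [Function.comp_apply, ENNReal.toReal_ofNat]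
  congr 1
  refine lintegral_congr_ae ?_
  filter_upwards [coeFn_mulOp hσ g, coeFn_mulOp ⟨hi, C, hi'⟩ g] with x h1 h2
  simp only [Pi.sub_apply, h1, h2]
  congr 2
  push_cast
  ring

end MulOp

/-! ### An energy estimate for linear evolution equations in a Hilbert space -/

section Energy

/-- A function whose increments are dominated by those of an absolutely continuous function is
absolutely continuous. -/
theorem AbsolutelyContinuousOnInterval.of_dist_le {X Y : Type*} [PseudoMetricSpace X]
    [PseudoMetricSpace Y] {f : ℝ → X} {g : ℝ → Y} {a b K : ℝ}
    (hg : AbsolutelyContinuousOnInterval g a b)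
    (h : ∀ x ∈ uIcc a b, ∀ y ∈ uIcc a b, dist (f x) (f y) ≤ K * dist (g x) (g y)) :
    AbsolutelyContinuousOnInterval f a b := by
  refine squeeze_zero' (Eventually.of_forall fun t => Finset.sum_nonneg fun i _ => dist_nonneg) ?_
    (by simpa using Tendsto.const_mul K hg)
  have : ∀ᶠ E in AbsolutelyContinuousOnInterval.totalLengthFilter ⊓
      𝓟 (AbsolutelyContinuousOnInterval.disjWithin a b),
      E ∈ AbsolutelyContinuousOnInterval.disjWithin a b :=
    eventually_inf_principal.mpr (by simp)
  filter_upwards [this] with E hE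
  rw [Finset.mul_sum]
  refine Finset.sum_le_sum fun i hi => ?_
  have := hE.1 i hi
  exact h _ this.1 _ this.2

variable {H : Type*} [NormedAddCommGroup H] [InnerProductSpace ℝ H]

theorem abs_inner_sub_inner_le (M : H →L[ℝ] H) (u v : H) :
    |inner ℝ u (M u) - inner ℝ v (M v)| ≤ ‖M‖ * (‖u‖ + ‖v‖) * ‖u - v‖ := by
  have h1 : inner ℝ u (M u) - inner ℝ v (M v) = inner ℝ (u - v) (M u) + inner ℝ v (M (u - v)) := by
    rw [map_sub, inner_sub_left, inner_sub_right]; ring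
  rw [h1]
  have h2 := abs_real_inner_le_norm (u - v) (M u)
  have h3 := abs_real_inner_le_norm v (M (u - v))
  have h4 := M.le_opNorm u
  have h5 := M.le_opNorm (u - v)
  calc _ ≤ ‖u - v‖ * ‖M u‖ + ‖v‖ * ‖M (u - v)‖ := (abs_add_le _ _).trans (add_le_add h2 h3)
    _ ≤ ‖u - v‖ * (‖M‖ * ‖u‖) + ‖v‖ * (‖M‖ * ‖u - v‖) := by gcongr
    _ = _ := by ring

/-- The energy identity `d/dt ⟨Y, M Y⟩ = 2 ⟨Y', M Y⟩` in integrated form. -/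
theorem inner_primitive_sub [CompleteSpace H] (M : H →L[ℝ] H) (hM : ∀ x y, inner ℝ (M x) y = inner ℝ x (M y))
    {h : ℝ → H} (hh : Integrable h) (y : H) (t : ℝ) :
    inner ℝ (y + ∫ s in (0 : ℝ)..t, h s) (M (y + ∫ s in (0 : ℝ)..t, h s)) - inner ℝ y (M y) =
      ∫ s in (0 : ℝ)..t, 2 * inner ℝ (h s) (M (y + ∫ r in (0 : ℝ)..s, h r)) := by
  set Y : ℝ → H := fun t => y + ∫ s in (0 : ℝ)..t, h s with hYdef
  have hi : ∀ a b, IntervalIntegrable h volume a b := fun a b => hh.intervalIntegrable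
  have hYc : Continuous Y := continuous_const.add (intervalIntegral.continuous_primitive hi 0)
  set E : ℝ → ℝ := fun t => inner ℝ (Y t) (M (Y t)) with hEdef
  obtain ⟨R, hR⟩ := (isCompact_uIcc (a := (0 : ℝ)) (b := t)).exists_bound_of_continuousOn
    hYc.continuousOn
  -- As `h` is merely integrable, `E` need not be differentiable everywhere. Its increments are
  -- controlled by those of the primitive of `‖h‖`, so `E` is absolutely continuous and is the
  -- integral of its almost everywhere derivative.
  have hac : AbsolutelyContinuousOnInterval E 0 t := by
    have hn : IntervalIntegrable (fun s => ‖h s‖) volume 0 t := (hi 0 t).norm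
    refine (hn.absolutelyContinuousOnInterval_intervalIntegral left_mem_uIcc).of_dist_le
      (K := ‖M‖ * (R + R)) fun x hx z hz => ?_
    rw [Real.dist_eq, Real.dist_eq]
    have h1 : ‖Y x - Y z‖ ≤ |(∫ v in (0 : ℝ)..x, ‖h v‖) - ∫ v in (0 : ℝ)..z, ‖h v‖| := by
      rw [intervalIntegral.integral_interval_sub_left hh.norm.intervalIntegrable
        hh.norm.intervalIntegrable]
      have : Y x - Y z = ∫ v in z..x, h v := by
        simp only [hYdef, add_sub_add_left_eq_sub]
        exact intervalIntegral.integral_interval_sub_left (hi _ _) (hi _ _)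
      rw [this]
      exact intervalIntegral.norm_integral_le_abs_integral_norm
    refine (abs_inner_sub_inner_le M (Y x) (Y z)).trans ?_
    have hR0 : 0 ≤ R := (norm_nonneg _).trans (hR x hx)
    gcongr
    · exact hR x hx
    · exact hR z hz
  have h1 := hac.integral_deriv_eq_sub
  have hE0 : E 0 = inner ℝ y (M y) := by simp [hEdef, hYdef]
  rw [hE0] at h1
  rw [← h1]
  refine intervalIntegral.integral_congr_ae ?_
  filter_upwards [(hi 0 t).ae_hasDerivAt_integral] with x hx hxt
  have hd : HasDerivAt Y (h x) x := by
    have := (hx (uIoc_subset_uIcc hxt) 0 left_mem_uIcc).const_add y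
    exact this
  have hd2 : HasDerivAt (fun t => M (Y t)) (M (h x)) x := M.hasFDerivAt.comp_hasDerivAt x hd
  have := (hd.inner ℝ hd2).deriv
  rw [hEdef, this, ← hM, real_inner_comm]
  ring

/-- By `MΛ = 1 - M` the term in `a` contributes `-2a(‖Y‖² - ⟨Y, MY⟩)`, and `Λ q` is tested against
`Y` as `⟨q, Y - MY⟩`, with no loss. Of the resulting `-2c₀‖Y‖²`, one half absorbs the source terms
by Young's inequality and the other half remains. -/
theorem energy_estimate_aux (M Λ : H →L[ℝ] H)
    (hM : ∀ x y, inner ℝ (M x) y = inner ℝ x (M y)) (hM0 : ∀ x, 0 ≤ inner ℝ x (M x))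
    (hM1 : ∀ x, ‖M x‖ ≤ ‖x‖) (hMΛ : ∀ x, M (Λ x) = x - M x) (hM2 : ∀ x, ‖x - M x‖ ≤ ‖x‖)
    {c c₀ a b β g : ℝ} (hc₀ : 0 < c₀) (hcc₀ : c₀ ≤ c) (hc₀' : c₀ ≤ 1)
    (ha : c ≤ a) (hb : |b| ≤ β) (Y p q : H) (hg : (‖p‖ + ‖q‖) ^ 2 ≤ g) :
    2 * inner ℝ (-(a • Λ Y) - b • Y + p + Λ q) (M Y) ≤
      (2 + 2 * β) * inner ℝ Y (M Y) - c₀ * ‖Y‖ ^ 2 + c₀⁻¹ * g := by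
  have h1 : inner ℝ (Λ Y) (M Y) = ‖Y‖ ^ 2 - inner ℝ Y (M Y) := by
    rw [← hM, hMΛ, inner_sub_left, real_inner_self_eq_norm_sq, hM]
  have h2 : inner ℝ (Λ q) (M Y) = inner ℝ q (Y - M Y) := by
    rw [← hM, hMΛ, inner_sub_left, inner_sub_right, hM]
  have h3 : inner ℝ p (M Y) ≤ ‖p‖ * ‖Y‖ :=
    (real_inner_le_norm _ _).trans (mul_le_mul_of_nonneg_left (hM1 Y) (norm_nonneg _))
  have h4 : inner ℝ q (Y - M Y) ≤ ‖q‖ * ‖Y‖ :=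
    (real_inner_le_norm _ _).trans (mul_le_mul_of_nonneg_left (hM2 Y) (norm_nonneg _))
  have h5 : inner ℝ Y (M Y) ≤ ‖Y‖ ^ 2 := by
    rw [sq]
    exact (real_inner_le_norm _ _).trans (mul_le_mul_of_nonneg_left (hM1 Y) (norm_nonneg _))
  rw [inner_add_left, inner_add_left, inner_sub_left, inner_neg_left, real_inner_smul_left,
    real_inner_smul_left, h1, h2]
  set e := inner ℝ Y (M Y)
  have he : 0 ≤ e := hM0 Y
  set y := ‖Y‖
  have h6 : c₀ * (y ^ 2 - e) ≤ a * (y ^ 2 - e) :=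
    mul_le_mul_of_nonneg_right (hcc₀.trans ha) (by linarith)
  have h7 : -(b * e) ≤ β * e := by
    rw [← neg_mul]
    exact mul_le_mul_of_nonneg_right ((neg_le_abs b).trans hb) he
  have h8 : c₀ * e ≤ e := mul_le_of_le_one_left he hc₀'
  have h9 : 2 * ((‖p‖ + ‖q‖) * y) ≤ c₀ * y ^ 2 + c₀⁻¹ * g := by
    have : c₀⁻¹ * (‖p‖ + ‖q‖) ^ 2 ≤ c₀⁻¹ * g := by gcongr
    have h10 : 0 ≤ c₀⁻¹ * (c₀ * y - (‖p‖ + ‖q‖)) ^ 2 := by positivity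
    have h11 : c₀⁻¹ * (c₀ * y - (‖p‖ + ‖q‖)) ^ 2 =
        c₀ * y ^ 2 - 2 * ((‖p‖ + ‖q‖) * y) + c₀⁻¹ * (‖p‖ + ‖q‖) ^ 2 := by
      field_simp
      ring
    linarith
  linarith

/-- Gronwall's inequality in integrated form. -/
theorem add_mul_integral_le_of_le {E : ℝ → ℝ} (hE : Continuous E) {κ K T : ℝ} (hκ : 0 ≤ κ)
    (hT : 0 ≤ T) (h : ∀ t ∈ Icc 0 T, E t ≤ K + κ * ∫ s in (0 : ℝ)..t, E s) :
    K + κ * ∫ s in (0 : ℝ)..T, E s ≤ K * Real.exp (κ * T) := by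
  set φ : ℝ → ℝ := fun t => K + κ * ∫ s in (0 : ℝ)..t, E s with hφ
  have hd : ∀ t, HasDerivAt φ (κ * E t) t := fun t =>
    ((hE.integral_hasStrictDerivAt 0 t).hasDerivAt.const_mul κ).const_add K
  have hd2 : ∀ t, HasDerivAt (fun t => φ t * Real.exp (-(κ * t)))
      (κ * E t * Real.exp (-(κ * t)) + φ t * (Real.exp (-(κ * t)) * -(κ * 1))) t := fun t =>
    (hd t).mul (((hasDerivAt_id t).const_mul κ).neg.exp)
  -- The hypothesis says `E ≤ φ`, that is `φ' ≤ κ φ`, so the integrating factor makes this product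
  -- nonincreasing.
  have hanti : AntitoneOn (fun t => φ t * Real.exp (-(κ * t))) (Icc 0 T) := by
    refine antitoneOn_of_deriv_nonpos (convex_Icc 0 T)
      (fun t _ => (hd2 t).continuousAt.continuousWithinAt)
      (fun t _ => (hd2 t).differentiableAt.differentiableWithinAt) fun t ht => ?_
    rw [(hd2 t).deriv]
    rw [interior_Icc] at ht
    have := h t (Ioo_subset_Icc_self ht)
    have h2 : κ * E t ≤ κ * φ t := mul_le_mul_of_nonneg_left this hκ
    nlinarith [Real.exp_pos (-(κ * t))]
  have := hanti (left_mem_Icc.mpr hT) (right_mem_Icc.mpr hT) hT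
  simp only [hφ, intervalIntegral.integral_same, mul_zero, add_zero, neg_zero, Real.exp_zero,
    mul_one] at this
  rw [Real.exp_neg, ← div_eq_mul_inv, div_le_iff₀ (Real.exp_pos _)] at this
  exact this

/-- The `L²` energy estimate for `Y' + a Λ Y + b Y = p + Λ q` where `M = (1 + Λ)⁻¹`. -/
theorem energy_estimate [CompleteSpace H] (M Λ : H →L[ℝ] H)
    (hM : ∀ x y, inner ℝ (M x) y = inner ℝ x (M y)) (hM0 : ∀ x, 0 ≤ inner ℝ x (M x))
    (hM1 : ∀ x, ‖M x‖ ≤ ‖x‖) (hMΛ : ∀ x, M (Λ x) = x - M x) (hM2 : ∀ x, ‖x - M x‖ ≤ ‖x‖)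
    {c c₀ T β : ℝ} (hT : 0 ≤ T) (hc₀ : 0 < c₀) (hcc₀ : c₀ ≤ c) (hc₀' : c₀ ≤ 1) (hβ : 0 ≤ β)
    {a b g : ℝ → ℝ} {Y p q h : ℝ → H} {y : H}
    (hi : IntegrableOn h (Icc 0 T)) (hY : ∀ t ∈ Icc 0 T, Y t = y + ∫ s in (0 : ℝ)..t, h s)
    (hh : ∀ᵐ s ∂volume.restrict (Icc 0 T),
      h s = -(a s • Λ (Y s)) - b s • Y s + p s + Λ (q s))
    (ha : ∀ᵐ s ∂volume.restrict (Icc 0 T), c ≤ a s)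
    (hb : ∀ᵐ s ∂volume.restrict (Icc 0 T), |b s| ≤ β)
    (hg : ∀ᵐ s ∂volume.restrict (Icc 0 T), (‖p s‖ + ‖q s‖) ^ 2 ≤ g s)
    (hgi : IntegrableOn g (Icc 0 T)) :
    ∫ s in (0 : ℝ)..T, ‖Y s‖ ^ 2 ≤
      c₀⁻¹ * ((‖y‖ ^ 2 + c₀⁻¹ * ∫ s in (0 : ℝ)..T, g s) * Real.exp ((2 + 2 * β) * T)) := by
  -- Nothing is known about `Y` and `h` off `[0,T]`. Extending `h` by zero gives a primitive `Z`
  -- that is continuous on the whole line and equals `Y` on `[0,T]`.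
  set h' : ℝ → H := (Icc 0 T).indicator h with hh'
  have hi' : Integrable h' := hi.integrable_indicator measurableSet_Icc
  set Z : ℝ → H := fun t => y + ∫ s in (0 : ℝ)..t, h' s with hZ
  have hZc : Continuous Z :=
    continuous_const.add (intervalIntegral.continuous_primitive (fun _ _ => hi'.intervalIntegrable) 0)
  have hYZ : ∀ t ∈ Icc 0 T, Y t = Z t := fun t ht => by
    rw [hY t ht, hZ]
    congr 1
    refine intervalIntegral.integral_congr fun s hs => ?_
    rw [uIcc_of_le ht.1] at hs
    exact (indicator_of_mem (s := Icc 0 T) ⟨hs.1, hs.2.trans ht.2⟩ h).symm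
  set E : ℝ → ℝ := fun t => inner ℝ (Z t) (M (Z t)) with hE
  have hEc : Continuous E := hZc.inner (M.continuous.comp hZc)
  have hint : ∀ t ∈ Icc 0 T, IntervalIntegrable g volume 0 t := fun t ht =>
    (intervalIntegrable_iff_integrableOn_Icc_of_le ht.1).mpr
      (hgi.mono_set (Icc_subset_Icc_right ht.2))
  have hg0 : ∀ᵐ s ∂volume.restrict (Icc 0 T), 0 ≤ g s := by
    filter_upwards [hg] with s hs using (sq_nonneg _).trans hs
  have hkey : ∀ t ∈ Icc 0 T, E t + c₀ * ∫ s in (0 : ℝ)..t, ‖Z s‖ ^ 2 ≤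
      (‖y‖ ^ 2 + c₀⁻¹ * ∫ s in (0 : ℝ)..T, g s) + (2 + 2 * β) * ∫ s in (0 : ℝ)..t, E s := by
    intro t ht
    have h1 := inner_primitive_sub M hM hi' y t
    have h2 : ∫ s in (0 : ℝ)..t, 2 * inner ℝ (h' s) (M (Z s)) ≤
        ∫ s in (0 : ℝ)..t, ((2 + 2 * β) * E s - c₀ * ‖Z s‖ ^ 2 + c₀⁻¹ * g s) := by
      refine intervalIntegral.integral_mono_ae_restrict ht.1 ?_ ?_ ?_
      · rw [intervalIntegrable_iff_integrableOn_Icc_of_le ht.1]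
        obtain ⟨R, hR⟩ := (isCompact_Icc (a := (0 : ℝ)) (b := t)).exists_bound_of_continuousOn
          (M.continuous.comp hZc).continuousOn
        refine Integrable.const_mul (Integrable.mono' (hi'.norm.mul_const R).integrableOn
          (hi'.1.restrict.inner (M.continuous.comp hZc).aestronglyMeasurable) ?_) 2
        filter_upwards [ae_restrict_mem measurableSet_Icc] with s hs
        exact (norm_inner_le_norm _ _).trans
          (mul_le_mul_of_nonneg_left (hR s hs) (norm_nonneg _))
      · exact (((hEc.const_mul _).sub ((hZc.norm.pow 2).const_mul _)).intervalIntegrable _ _).add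
          ((hint t ht).const_mul _)
      · have hsub : volume.restrict (Icc 0 t) ≤ volume.restrict (Icc 0 T) :=
          Measure.restrict_mono (Icc_subset_Icc_right ht.2) le_rfl
        filter_upwards [ae_mono hsub hh, ae_mono hsub ha, ae_mono hsub hb, ae_mono hsub hg,
          ae_restrict_mem measurableSet_Icc] with s h1 h2 h3 h4 h5
        have h5' : s ∈ Icc 0 T := ⟨h5.1, h5.2.trans ht.2⟩
        have h6 : h' s = -(a s • Λ (Z s)) - b s • Z s + p s + Λ (q s) := by
          rw [hh', indicator_of_mem h5', h1, hYZ s h5']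
        rw [h6]
        exact energy_estimate_aux M Λ hM hM0 hM1 hMΛ hM2 hc₀ hcc₀ hc₀' h2 h3 _ _ _ h4
    rw [← h1, intervalIntegral.integral_add, intervalIntegral.integral_sub,
      intervalIntegral.integral_const_mul, intervalIntegral.integral_const_mul,
      intervalIntegral.integral_const_mul] at h2
    · have h3 : inner ℝ y (M y) ≤ ‖y‖ ^ 2 := by
        rw [sq]
        exact (real_inner_le_norm _ _).trans (mul_le_mul_of_nonneg_left (hM1 y) (norm_nonneg _))
      have h4 : ∫ s in (0 : ℝ)..t, g s ≤ ∫ s in (0 : ℝ)..T, g s := by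
        refine intervalIntegral.integral_mono_interval le_rfl ht.1 ht.2 ?_
          (hint T (right_mem_Icc.mpr hT))
        exact ae_mono (Measure.restrict_mono Ioc_subset_Icc_self le_rfl) hg0
      have h5 : c₀⁻¹ * ∫ s in (0 : ℝ)..t, g s ≤ c₀⁻¹ * ∫ s in (0 : ℝ)..T, g s := by gcongr
      change E t - _ ≤ _ at h2
      linarith
    · exact (hEc.const_mul _).intervalIntegrable _ _
    · exact ((hZc.norm.pow 2).const_mul _).intervalIntegrable _ _
    · exact ((hEc.const_mul _).sub ((hZc.norm.pow 2).const_mul _)).intervalIntegrable _ _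
    · exact (hint t ht).const_mul _
  have hκ : 0 ≤ 2 + 2 * β := by positivity
  -- The dissipation `c₀ ∫ ‖Z‖²` is dropped to run Gronwall on `E`. It is kept in `hkey` at time
  -- `T`, where it gives the conclusion.
  have hgr := add_mul_integral_le_of_le hEc hκ hT fun t ht => by
    refine le_trans ?_ (hkey t ht)
    have : 0 ≤ ∫ s in (0 : ℝ)..t, ‖Z s‖ ^ 2 :=
      intervalIntegral.integral_nonneg ht.1 fun s _ => by positivity
    nlinarith
  have hfin := (hkey T (right_mem_Icc.mpr hT)).trans hgr
  have hE0 : 0 ≤ E T := hM0 _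
  have hcongr : ∫ s in (0 : ℝ)..T, ‖Y s‖ ^ 2 = ∫ s in (0 : ℝ)..T, ‖Z s‖ ^ 2 :=
    intervalIntegral.integral_congr fun s hs => by
      rw [uIcc_of_le hT] at hs
      simp only [hYZ s hs]
  rw [hcongr, inv_mul_eq_div, le_div_iff₀ hc₀]
  linarith

end Energy

/-! ### Fourier multipliers between Sobolev spaces -/

namespace Sob

variable {n : ℕ} {m m' m'' α : ℝ} {σ τ : EuclideanSpace ℝ (Fin n) → ℝ}

/-- The inner product of `H^m(ℝⁿ)`, taken on the side of the weighted Fourier transforms. -/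
abbrev innerProductSpace : InnerProductSpace ℂ (Sob n m) where
  inner u v := inner ℂ (weightedFourier n m u) (weightedFourier n m v)
  norm_sq_eq_re_inner u := by
    rw [← (weightedFourier n m).norm_map, norm_sq_eq_re_inner (𝕜 := ℂ)]
  conj_inner_symm u v := inner_conj_symm _ _
  add_left u v w := by rw [map_add, inner_add_left]
  smul_left u v r := by rw [map_smul, inner_smul_left]

attribute [local instance] innerProductSpace

theorem inner_def (u v : Sob n m) :
    inner ℂ u v = inner ℂ (weightedFourier n m u) (weightedFourier n m v) := rfl

/-- The Fourier multiplier from `H^m` to `H^m'` that is multiplication by `σ` on the side of the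
weighted Fourier transforms. -/
def mult (m m' : ℝ) (σ : EuclideanSpace ℝ (Fin n) → ℝ) : Sob n m →L[ℂ] Sob n m' :=
  (weightedFourier n m').symm.toContinuousLinearEquiv.toContinuousLinearMap.comp
    ((mulOp volume σ).comp (weightedFourier n m).toContinuousLinearEquiv.toContinuousLinearMap)

theorem weightedFourier_mult (u : Sob n m) :
    weightedFourier n m' (mult m m' σ u) = mulOp volume σ (weightedFourier n m u) :=
  (weightedFourier n m').apply_symm_apply _

theorem mult_mult (hσ : BddMeas σ) (hτ : BddMeas τ) (u : Sob n m) :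
    mult m' m'' σ (mult m m' τ u) = mult m m'' (fun ξ => σ ξ * τ ξ) u := by
  apply (weightedFourier n m'').injective
  rw [weightedFourier_mult, weightedFourier_mult, weightedFourier_mult, mulOp_mulOp hσ hτ]

theorem mult_mult_of_eq {ρ : EuclideanSpace ℝ (Fin n) → ℝ} (hσ : BddMeas σ) (hτ : BddMeas τ)
    (h : ∀ ξ, σ ξ * τ ξ = ρ ξ) (u : Sob n m) :
    mult m' m'' σ (mult m m' τ u) = mult m m'' ρ u := by
  rw [mult_mult hσ hτ, funext h]

theorem mult_add (hσ : BddMeas σ) (hτ : BddMeas τ) (u : Sob n m) :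
    mult m m' (fun ξ => σ ξ + τ ξ) u = mult m m' σ u + mult m m' τ u := by
  apply (weightedFourier n m').injective
  rw [map_add, weightedFourier_mult, weightedFourier_mult, weightedFourier_mult,
    mulOp_add_apply hσ hτ]

theorem mult_const (c : ℝ) (u : Sob n m) : mult m m (fun _ => c) u = (c : ℂ) • u := by
  apply (weightedFourier n m).injective
  rw [weightedFourier_mult, mulOp_const_apply, map_smul]

theorem mult_one (u : Sob n m) : mult m m (fun _ => 1) u = u := by
  simpa using mult_const 1 u

theorem norm_mult_apply_le {C : ℝ} (hm : Measurable σ) (hC : ∀ ξ, |σ ξ| ≤ C) (u : Sob n m) :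
    ‖mult m m' σ u‖ ≤ C * ‖u‖ := by
  rw [← (weightedFourier n m').norm_map, ← (weightedFourier n m).norm_map u, weightedFourier_mult]
  exact norm_mulOp_apply_le hm hC _

theorem inner_mult_left (hσ : BddMeas σ) (u v : Sob n m) :
    inner ℂ (mult m m σ u) v = inner ℂ u (mult m m σ v) := by
  rw [inner_def, inner_def, weightedFourier_mult, weightedFourier_mult, inner_mulOp_left hσ]

theorem tendsto_mult_apply {ι : Type*} {l : Filter ι} [l.IsCountablyGenerated]
    {σ' : ι → EuclideanSpace ℝ (Fin n) → ℝ} {C : ℝ} (hm : ∀ᶠ i in l, Measurable (σ' i))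
    (hC : ∀ᶠ i in l, ∀ ξ, |σ' i ξ| ≤ C) (hσ : BddMeas σ)
    (hlim : ∀ ξ, Tendsto (fun i => σ' i ξ) l (𝓝 (σ ξ))) (u : Sob n m) :
    Tendsto (fun i => mult m m' (σ' i) u) l (𝓝 (mult m m' σ u)) :=
  ((weightedFourier n m').symm.continuous.tendsto _).comp
    (tendsto_mulOp_apply hm hC hσ hlim (weightedFourier n m u))

/-- The symbol `|2πξ|^(2α)`. -/
def lapSymbol (α : ℝ) {n : ℕ} (ξ : EuclideanSpace ℝ (Fin n)) : ℝ := (2 * Real.pi * ‖ξ‖) ^ (2 * α)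

/-- The weight `(1 + |ξ|²)^(-α)`. -/
def weight (α : ℝ) {n : ℕ} (ξ : EuclideanSpace ℝ (Fin n)) : ℝ := (1 + ‖ξ‖ ^ 2) ^ (-α)

theorem lapSymbol_nonneg (α : ℝ) (ξ : EuclideanSpace ℝ (Fin n)) : 0 ≤ lapSymbol α ξ :=
  Real.rpow_nonneg (by positivity) _

theorem weight_pos (α : ℝ) (ξ : EuclideanSpace ℝ (Fin n)) : 0 < weight α ξ :=
  Real.rpow_pos_of_pos (by positivity) _

theorem measurable_lapSymbol (α : ℝ) : Measurable (lapSymbol α (n := n)) := by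
  unfold lapSymbol; fun_prop

theorem measurable_weight (α : ℝ) : Measurable (weight α (n := n)) := by
  unfold weight; fun_prop

theorem bddMeas_weight (hα : 0 ≤ α) : BddMeas (weight α (n := n)) := by
  refine ⟨measurable_weight α, 1, fun ξ => ?_⟩
  rw [abs_of_pos (weight_pos α ξ)]
  exact Real.rpow_le_one_of_one_le_of_nonpos (by nlinarith [sq_nonneg ‖ξ‖]) (by linarith)

theorem fracSymbol_eq (α : ℝ) (ξ : EuclideanSpace ℝ (Fin n)) :
    fracSymbol α ξ = ((lapSymbol α ξ * weight α ξ : ℝ) : ℂ) := rfl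

theorem bddMeas_lapSymbol_mul_weight (hα : 0 ≤ α) :
    BddMeas fun ξ : EuclideanSpace ℝ (Fin n) => lapSymbol α ξ * weight α ξ := by
  refine ⟨(measurable_lapSymbol α).mul (measurable_weight α), (2 * Real.pi) ^ (2 * α), fun ξ => ?_⟩
  have := norm_fracSymbol_le hα ξ
  rwa [fracSymbol_eq, Complex.norm_real] at this

theorem fracLap_eq_mult (hα : 0 ≤ α) (u : Sob n m) :
    fracLap hα u = mult m (m - 2 * α) (fun ξ => lapSymbol α ξ * weight α ξ) u := by
  apply (weightedFourier n (m - 2 * α)).injective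
  rw [weightedFourier_mult, fracLap, LinearIsometryEquiv.apply_symm_apply]
  refine Lp.ext ?_
  filter_upwards [coeFn_mulOp (bddMeas_lapSymbol_mul_weight hα) (weightedFourier n m u),
    (memLp_fracSymbol_mul hα (weightedFourier n m u)).coeFn_toLp] with ξ h1 h2
  rw [h1, h2, fracSymbol_eq]

/-- Matches multiplication of a tempered distribution by the smooth weight with multiplication in
`L²`; this is what lets the inclusion of Sobolev spaces be read as a multiplier. -/
theorem smulLeftCLM_weight (hα : 0 ≤ α) (g : Lp ℂ 2 (volume : Measure (EuclideanSpace ℝ (Fin n)))) :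
    TemperedDistribution.smulLeftCLM ℂ (fun ξ => (weight α ξ : ℂ))
      (Lp.toTemperedDistributionCLM ℂ volume 2 g) =
      Lp.toTemperedDistributionCLM ℂ volume 2 (mulOp volume (weight α) g) := by
  have htg : Function.HasTemperateGrowth fun ξ : EuclideanSpace ℝ (Fin n) => (weight α ξ : ℂ) := by
    unfold weight; fun_prop
  have hb := bddMeas_weight (n := n) hα
  have hmem : MemLp (fun ξ : EuclideanSpace ℝ (Fin n) => (weight α ξ : ℂ)) ⊤ volume := by
    obtain ⟨C, hC⟩ := hb.2
    refine memLp_top_of_bound (Complex.measurable_ofReal.comp hb.1).aestronglyMeasurable C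
      (Eventually.of_forall fun ξ => ?_)
    rw [Complex.norm_real]
    exact hC ξ
  rw [Lp.toTemperedDistributionCLM_apply, Lp.toTemperedDistributionCLM_apply,
    ← Lp.toTemperedDistribution_smul_eq (p := ⊤) (q := 2) (r := 2) htg hmem]
  congr 1
  refine Lp.ext ?_
  filter_upwards [coeFn_mulOp hb g, Lp.coeFn_lpSMul (r := 2) (hmem.toLp) g, hmem.coeFn_toLp]
    with ξ h1 h2 h3
  rw [h1, h2, Pi.smul_apply', h3, smul_eq_mul]

/-- The inclusion of `H^m` in `H^(m-2α)` as a multiplier. -/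
theorem toDist_mult_weight (hα : 0 ≤ α) (u : Sob n m) :
    toDist n (m - 2 * α) (mult m (m - 2 * α) (weight α) u) = toDist n m u := by
  have h1 := weightedFourier_spec (mult m (m - 2 * α) (weight α) u)
  rw [weightedFourier_mult, ← smulLeftCLM_weight hα, ← weightedFourier_spec u,
    TemperedDistribution.smulLeftCLM_smulLeftCLM_apply (by fun_prop)
      (by unfold weight; fun_prop)] at h1
  -- The weights combine because `m/2 - α = (m - 2α)/2`. Both distributions then have the same
  -- Bessel potential of order `m - 2α`, which is invertible.
  have h2 : ((fun x : EuclideanSpace ℝ (Fin n) => (((1 + ‖x‖ ^ 2) ^ (m / 2) : ℝ) : ℂ)) *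
      fun ξ => (weight α ξ : ℂ)) =
      fun x => (((1 + ‖x‖ ^ 2) ^ ((m - 2 * α) / 2) : ℝ) : ℂ) := by
    funext x
    rw [Pi.mul_apply, weight, ← Complex.ofReal_mul, ← Real.rpow_add (by positivity)]
    congr 2
    ring
  rw [h2, ← TemperedDistribution.fourier_besselPotential_eq_smulLeftCLM_fourier_apply,
    ← TemperedDistribution.fourier_besselPotential_eq_smulLeftCLM_fourier_apply] at h1
  have h3 := congrArg (fun v => 𝓕⁻ v) h1
  simp only [FourierTransform.fourierInv_fourier_eq] at h3
  have h4 := congrArg (TemperedDistribution.besselPotential _ ℂ (-(m - 2 * α))) h3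
  simpa using h4

/-- The indicator function of the ball of radius `k`. -/
def cutoff (k : ℕ) {n : ℕ} (ξ : EuclideanSpace ℝ (Fin n)) : ℝ :=
  (Metric.closedBall 0 k).indicator 1 ξ

theorem measurable_cutoff (k : ℕ) : Measurable (cutoff k (n := n)) :=
  measurable_one.indicator Metric.isClosed_closedBall.measurableSet

theorem cutoff_nonneg (k : ℕ) (ξ : EuclideanSpace ℝ (Fin n)) : 0 ≤ cutoff k ξ :=
  indicator_nonneg (fun _ _ => zero_le_one) _

theorem abs_cutoff_le (k : ℕ) (ξ : EuclideanSpace ℝ (Fin n)) : |cutoff k ξ| ≤ 1 := by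
  rw [abs_of_nonneg (cutoff_nonneg k ξ)]
  exact indicator_apply_le' (fun _ => le_rfl) fun _ => zero_le_one

theorem bddMeas_cutoff (k : ℕ) : BddMeas (cutoff k (n := n)) :=
  ⟨measurable_cutoff k, 1, abs_cutoff_le k⟩

theorem cutoff_mul_self (k : ℕ) (ξ : EuclideanSpace ℝ (Fin n)) :
    cutoff k ξ * cutoff k ξ = cutoff k ξ := by
  unfold cutoff
  by_cases h : ξ ∈ Metric.closedBall (0 : EuclideanSpace ℝ (Fin n)) k <;> simp [h]

theorem tendsto_cutoff (ξ : EuclideanSpace ℝ (Fin n)) :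
    Tendsto (fun k : ℕ => cutoff k ξ) atTop (𝓝 1) := by
  refine tendsto_const_nhds.congr' ?_
  filter_upwards [eventually_ge_atTop ⌈‖ξ‖⌉₊] with k hk
  have : ξ ∈ Metric.closedBall (0 : EuclideanSpace ℝ (Fin n)) k := by
    rw [mem_closedBall_zero_iff]
    exact Nat.ceil_le.mp hk
  simp [cutoff, this]

/-- Bounded on balls implies bounded after the cutoff. -/
theorem bddMeas_cutoff_mul (k : ℕ) (hm : Measurable σ) {C : ℝ}
    (hC : ∀ ξ, ‖ξ‖ ≤ k → |σ ξ| ≤ C) : BddMeas fun ξ => cutoff k ξ * σ ξ := by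
  refine ⟨(measurable_cutoff k).mul hm, |C|, fun ξ => ?_⟩
  unfold cutoff
  by_cases h : ξ ∈ Metric.closedBall (0 : EuclideanSpace ℝ (Fin n)) k
  · simpa [h] using (hC ξ (mem_closedBall_zero_iff.mp h)).trans (le_abs_self C)
  · simp [h]

/-- The symbol of the fractional Laplacian restricted to a ball. -/
def cutLap (α : ℝ) (k : ℕ) {n : ℕ} (ξ : EuclideanSpace ℝ (Fin n)) : ℝ := cutoff k ξ * lapSymbol α ξ

theorem cutLap_nonneg (α : ℝ) (k : ℕ) (ξ : EuclideanSpace ℝ (Fin n)) : 0 ≤ cutLap α k ξ :=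
  mul_nonneg (cutoff_nonneg k ξ) (lapSymbol_nonneg α ξ)

theorem bddMeas_cutLap (hα : 0 ≤ α) (k : ℕ) : BddMeas (cutLap α k (n := n)) := by
  refine bddMeas_cutoff_mul k (measurable_lapSymbol α)
    (C := (2 * Real.pi * k) ^ (2 * α)) fun ξ hξ => ?_
  rw [abs_of_nonneg (lapSymbol_nonneg α ξ)]
  have := Real.pi_pos
  exact Real.rpow_le_rpow (by positivity) (by gcongr) (by positivity)

theorem cutoff_mul_cutLap (α : ℝ) (k : ℕ) (ξ : EuclideanSpace ℝ (Fin n)) :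
    cutoff k ξ * cutLap α k ξ = cutLap α k ξ := by
  rw [cutLap, ← mul_assoc, cutoff_mul_self]

theorem bddMeas_cutoff_mul_inv_weight (hα : 0 ≤ α) (k : ℕ) :
    BddMeas fun ξ : EuclideanSpace ℝ (Fin n) => cutoff k ξ * (weight α ξ)⁻¹ := by
  refine bddMeas_cutoff_mul k (measurable_weight α).inv (C := (1 + (k : ℝ) ^ 2) ^ α) fun ξ hξ => ?_
  rw [abs_of_pos (inv_pos.mpr (weight_pos α ξ)), weight, Real.rpow_neg (by positivity), inv_inv]
  exact Real.rpow_le_rpow (by positivity) (by gcongr) hα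

/-- The restriction to frequencies in the ball of radius `k`. -/
abbrev cutOp (n : ℕ) (m : ℝ) (k : ℕ) : Sob n m →L[ℂ] Sob n m := mult m m (cutoff k)

/-- The fractional Laplacian on frequencies in the ball of radius `k`. -/
abbrev cutLapOp (n : ℕ) (m α : ℝ) (k : ℕ) : Sob n m →L[ℂ] Sob n m := mult m m (cutLap α k)

/-- The inverse of the inclusion of `H^m` in `H^(m-2α)` on frequencies in the ball of radius `k`. -/
abbrev cutLift (n : ℕ) (m α : ℝ) (k : ℕ) : Sob n (m - 2 * α) →L[ℂ] Sob n m :=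
  mult (m - 2 * α) m fun ξ => cutoff k ξ * (weight α ξ)⁻¹

theorem tendsto_cutOp (u : Sob n m) : Tendsto (fun k => cutOp n m k u) atTop (𝓝 u) := by
  have := tendsto_mult_apply (m := m) (m' := m) (Eventually.of_forall measurable_cutoff)
    (Eventually.of_forall abs_cutoff_le) (BddMeas.const 1) tendsto_cutoff u
  rwa [mult_one] at this

theorem norm_cutOp_le (k : ℕ) (u : Sob n m) : ‖cutOp n m k u‖ ≤ ‖u‖ := by
  simpa using norm_mult_apply_le (m := m) (m' := m) (measurable_cutoff k) (abs_cutoff_le k) u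

/-- On a ball of frequencies the weight can be divided out again, so the fractional Laplacian, which
lands in `H^(m-2α)`, is brought back to a bounded operator on `H^m`. -/
theorem cutLift_fracLap (hα : 0 ≤ α) (k : ℕ) (u : Sob n m) :
    cutLift n m α k (fracLap hα u) = cutLapOp n m α k u := by
  rw [fracLap_eq_mult]
  refine mult_mult_of_eq (bddMeas_cutoff_mul_inv_weight hα k) (bddMeas_lapSymbol_mul_weight hα)
    (fun ξ => ?_) u
  have := (weight_pos α ξ).ne'
  rw [cutLap]
  field_simp

theorem cutLift_mult_weight (hα : 0 ≤ α) (k : ℕ) (u : Sob n m) :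
    cutLift n m α k (mult m (m - 2 * α) (weight α) u) = cutOp n m k u := by
  refine mult_mult_of_eq (bddMeas_cutoff_mul_inv_weight hα k) (bddMeas_weight hα) (fun ξ => ?_) u
  have := (weight_pos α ξ).ne'
  field_simp

theorem cutLapOp_cutOp (hα : 0 ≤ α) (k : ℕ) (u : Sob n m) :
    cutLapOp n m α k (cutOp n m k u) = cutLapOp n m α k u := by
  refine mult_mult_of_eq (bddMeas_cutLap hα k) (bddMeas_cutoff k) (fun ξ => ?_) u
  rw [mul_comm, cutoff_mul_cutLap]

/-- An element of `H^(m-2α)` vanishes if all its cutoffs do. -/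
theorem eq_zero_of_cutLift_eq_zero (hα : 0 ≤ α) {v : Sob n (m - 2 * α)}
    (h : ∀ k, cutLift n m α k v = 0) : v = 0 := by
  have h2 : ∀ k, cutOp n (m - 2 * α) k v = 0 := fun k => by
    have h3 : cutOp n (m - 2 * α) k v =
        mult m (m - 2 * α) (weight α) (cutLift n m α k v) := by
      refine (mult_mult_of_eq (bddMeas_weight hα) (bddMeas_cutoff_mul_inv_weight hα k)
        (fun ξ => ?_) v).symm
      have := (weight_pos α ξ).ne'
      field_simp
    rw [h3, h k, map_zero]
  have h5 := tendsto_cutOp v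
  simp only [h2] at h5
  exact (tendsto_const_nhds_iff.mp h5).symm

/-- Identities between distributions in `H^m + H^(m-2α)` can be checked after a cutoff. -/
theorem toDist_add_toDist_eq_iff (hα : 0 ≤ α) (u v : Sob n m) (w : Sob n (m - 2 * α)) :
    toDist n m u + toDist n (m - 2 * α) w = toDist n m v ↔
      ∀ k, cutOp n m k u + cutLift n m α k w = cutOp n m k v := by
  -- All terms are moved into `H^(m-2α)`, where equality of distributions is equality of elements.
  rw [← toDist_mult_weight hα u, ← toDist_mult_weight hα v, ← map_add,
    toDist_injective.eq_iff]
  constructor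
  · intro h k
    rw [← cutLift_mult_weight hα, ← cutLift_mult_weight hα, ← map_add, h]
  · intro h
    rw [← sub_eq_zero]
    refine eq_zero_of_cutLift_eq_zero (m := m) hα fun k => ?_
    rw [map_sub, map_add, cutLift_mult_weight hα, cutLift_mult_weight hα, h, sub_self]

end Sob

/-! ### Solutions of the Cauchy problem with continuous coefficients -/

namespace Sob

variable {n : ℕ} {m m' α : ℝ} {σ τ : EuclideanSpace ℝ (Fin n) → ℝ}

attribute [local instance] innerProductSpace

theorem mult_real_smul (r : ℝ) (u : Sob n m) : mult m m' σ (r • u) = r • mult m m' σ u :=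
  (mult m m' σ).map_smul_of_tower r u

theorem mult_const_mul (hσ : BddMeas σ) (r : ℝ) (u : Sob n m) :
    mult m m (fun ξ => r * σ ξ) u = r • mult m m σ u := by
  rw [← mult_mult (m' := m) (BddMeas.const r) hσ, mult_const]
  exact Complex.coe_smul r _

theorem mult_sub (hσ : BddMeas σ) (hτ : BddMeas τ) (u : Sob n m) :
    mult m m (fun ξ => σ ξ - τ ξ) u = mult m m σ u - mult m m τ u := by
  have h := mult_add (m := m) (m' := m) (hσ.sub hτ) hτ u
  simp only [sub_add_cancel] at h
  rw [h, add_sub_cancel_right]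

/-- The Cauchy problem in integrated form can be checked after a cutoff. -/
theorem equation_iff (hα : 0 ≤ α) {a b : ℝ → ℝ} {f u : ℝ → Sob n m} {u₀ : Sob n m} {t : ℝ}
    (ha : IntervalIntegrable (fun s => a s • u s) volume 0 t)
    (hb : IntervalIntegrable (fun s => b s • u s) volume 0 t)
    (hf : IntervalIntegrable f volume 0 t) :
    toDist n m (u t) + toDist n (m - 2 * α) (∫ s in (0 : ℝ)..t, a s • fracLap hα (u s))
        + toDist n m (∫ s in (0 : ℝ)..t, b s • u s) =
      toDist n m u₀ + toDist n m (∫ s in (0 : ℝ)..t, f s) ↔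
    ∀ k, cutOp n m k (u t) + (∫ s in (0 : ℝ)..t, a s • cutLapOp n m α k (u s))
        + (∫ s in (0 : ℝ)..t, b s • cutOp n m k (u s)) =
      cutOp n m k u₀ + ∫ s in (0 : ℝ)..t, cutOp n m k (f s) := by
  rw [add_right_comm, ← map_add, ← map_add, toDist_add_toDist_eq_iff hα]
  refine forall_congr' fun k => ?_
  have h1 : cutLift n m α k (∫ s in (0 : ℝ)..t, a s • fracLap hα (u s)) =
      ∫ s in (0 : ℝ)..t, a s • cutLapOp n m α k (u s) := by
    rw [← ContinuousLinearMap.intervalIntegral_comp_comm]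
    · refine intervalIntegral.integral_congr fun s _ => ?_
      simp only [cutLift, mult_real_smul]
      congr 1
      exact cutLift_fracLap hα k (u s)
    · simp only [fracLap_eq_mult, ← mult_real_smul]
      exact ⟨(mult m (m - 2 * α) _).integrable_comp ha.1,
        (mult m (m - 2 * α) _).integrable_comp ha.2⟩
  have h2 : cutOp n m k (∫ s in (0 : ℝ)..t, b s • u s) =
      ∫ s in (0 : ℝ)..t, b s • cutOp n m k (u s) := by
    rw [← ContinuousLinearMap.intervalIntegral_comp_comm _ hb]
    exact intervalIntegral.integral_congr fun s _ => mult_real_smul _ _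
  rw [map_add, map_add, h1, h2, ← ContinuousLinearMap.intervalIntegral_comp_comm _ hf,
    add_right_comm]

/-- The heat semigroup `exp (-τ (-𝓛)^α)`, extended by the identity to `τ ≤ 0`. -/
def heat (n : ℕ) (m α τ : ℝ) : Sob n m →L[ℂ] Sob n m :=
  mult m m fun ξ => Real.exp (-(max τ 0 * lapSymbol α ξ))

theorem abs_heatSymbol_le (α τ : ℝ) (ξ : EuclideanSpace ℝ (Fin n)) :
    |Real.exp (-(max τ 0 * lapSymbol α ξ))| ≤ 1 := by
  rw [Real.abs_exp, Real.exp_le_one_iff, neg_nonpos]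
  exact mul_nonneg (le_max_right _ _) (lapSymbol_nonneg α ξ)

theorem measurable_heatSymbol (α τ : ℝ) :
    Measurable fun ξ : EuclideanSpace ℝ (Fin n) => Real.exp (-(max τ 0 * lapSymbol α ξ)) :=
  Real.measurable_exp.comp ((measurable_lapSymbol α).const_mul _).neg

/-- Strong continuity, by dominated convergence: the symbols depend continuously on time at each
frequency and are bounded by one. -/
theorem tendsto_heat (u : Sob n m) (τ : ℝ) :
    Tendsto (fun t => heat n m α t u) (𝓝 τ) (𝓝 (heat n m α τ u)) := by
  refine tendsto_mult_apply (C := 1)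
    (σ' := fun t (ξ : EuclideanSpace ℝ (Fin n)) => Real.exp (-(max t 0 * lapSymbol α ξ)))
    (Eventually.of_forall fun t => measurable_heatSymbol α t)
    (Eventually.of_forall fun t => abs_heatSymbol_le α t)
    ⟨measurable_heatSymbol α τ, 1, abs_heatSymbol_le α τ⟩ (fun ξ => ?_) u
  have : Continuous fun t : ℝ => Real.exp (-(max t 0 * lapSymbol α ξ)) := by fun_prop
  exact this.tendsto τ

theorem norm_heat_le (τ : ℝ) (u : Sob n m) : ‖heat n m α τ u‖ ≤ ‖u‖ := by
  simpa [heat] using norm_mult_apply_le (m := m) (m' := m) (measurable_heatSymbol α τ)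
    (abs_heatSymbol_le α τ) u

/-- Strong continuity combined with the contraction bound gives joint continuity in time and
argument. -/
theorem _root_.Continuous.sob_heat {X : Type*} [TopologicalSpace X] {τ : X → ℝ} {u : X → Sob n m}
    (hτ : Continuous τ) (hu : Continuous u) : Continuous fun x => heat n m α (τ x) (u x) := by
  rw [continuous_iff_continuousAt]
  intro x
  have h1 : Tendsto (fun y => heat n m α (τ y) (u x)) (𝓝 x) (𝓝 (heat n m α (τ x) (u x))) :=
    (tendsto_heat (u x) (τ x)).comp (hτ.tendsto x)
  have h2 : Tendsto (fun y => heat n m α (τ y) (u y - u x)) (𝓝 x) (𝓝 0) := by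
    refine squeeze_zero_norm (fun y => norm_heat_le (τ y) (u y - u x)) ?_
    have : Continuous fun y => ‖u y - u x‖ := (hu.sub continuous_const).norm
    simpa using this.tendsto x
  have h3 := h2.add h1
  rw [zero_add] at h3
  refine h3.congr fun y => ?_
  rw [← map_add, sub_add_cancel]

/-- The group generated by the fractional Laplacian on frequencies in a ball. -/
def cutHeat (n : ℕ) (m α : ℝ) (k : ℕ) (τ : ℝ) : Sob n m →L[ℂ] Sob n m :=
  mult m m fun ξ => Real.exp (-(τ * cutLap α k ξ))

theorem bddMeas_cutHeatSymbol (hα : 0 ≤ α) (k : ℕ) (τ : ℝ) :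
    BddMeas fun ξ : EuclideanSpace ℝ (Fin n) => Real.exp (-(τ * cutLap α k ξ)) := by
  obtain ⟨hm, C, hC⟩ := bddMeas_cutLap (n := n) hα k
  refine ⟨Real.measurable_exp.comp (hm.const_mul τ).neg, Real.exp (|τ| * C), fun ξ => ?_⟩
  rw [Real.abs_exp, Real.exp_le_exp]
  refine (neg_le_abs _).trans ?_
  rw [abs_mul]
  exact mul_le_mul_of_nonneg_left (hC ξ) (abs_nonneg τ)

theorem cutHeat_add (hα : 0 ≤ α) (k : ℕ) (s t : ℝ) (u : Sob n m) :
    cutHeat n m α k s (cutHeat n m α k t u) = cutHeat n m α k (s + t) u := by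
  refine mult_mult_of_eq (bddMeas_cutHeatSymbol hα k s) (bddMeas_cutHeatSymbol hα k t)
    (fun ξ => ?_) u
  rw [← Real.exp_add]
  congr 1
  ring

theorem cutHeat_zero (k : ℕ) (u : Sob n m) : cutHeat n m α k 0 u = u := by
  simpa [cutHeat] using mult_one u

/-- The two symbols agree on the ball and the cutoff kills both outside it. Nonnegative time is
essential: `heat` is frozen at the identity for negative times, whereas `cutHeat` is a group. -/
theorem cutOp_heat (hα : 0 ≤ α) (k : ℕ) {t : ℝ} (ht : 0 ≤ t) (u : Sob n m) :
    cutOp n m k (heat n m α t u) = cutHeat n m α k t (cutOp n m k u) := by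
  have h1 := mult_mult (m := m) (m' := m) (m'' := m) (bddMeas_cutoff k)
    ⟨measurable_heatSymbol α t, 1, abs_heatSymbol_le α t⟩ u
  have h2 := mult_mult (m := m) (m' := m) (m'' := m) (bddMeas_cutHeatSymbol hα k t)
    (bddMeas_cutoff k) u
  refine h1.trans (Eq.trans ?_ h2.symm)
  congr 2
  funext ξ
  rw [max_eq_left ht, cutLap, cutoff]
  by_cases h : ξ ∈ Metric.closedBall (0 : EuclideanSpace ℝ (Fin n)) k <;> simp [h]

/-- The generator is bounded, so the derivative exists in operator norm. With `x = cutLap α k`, the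
remainder has symbol `exp (-t x) (exp (-h x) - 1 + h x)`, which is at most `D (C |h|)²` once `C |h|
< 1`; here `C` bounds `x` and `D` bounds `exp (-t x)`. -/
theorem hasDerivAt_cutHeat (hα : 0 ≤ α) (k : ℕ) (t : ℝ) :
    HasDerivAt (fun t => (cutHeat n m α k t).restrictScalars ℝ)
      (-((cutLapOp n m α k).comp (cutHeat n m α k t)).restrictScalars ℝ) t := by
  obtain ⟨hm, C, hC⟩ := bddMeas_cutLap (n := n) hα k
  obtain ⟨hm', D, hD⟩ := bddMeas_cutHeatSymbol (n := n) hα k t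
  have hC0 : 0 ≤ C := (abs_nonneg _).trans (hC 0)
  have hD0 : 0 ≤ D := (abs_nonneg _).trans (hD 0)
  rw [hasDerivAt_iff_isLittleO_nhds_zero]
  refine Asymptotics.IsBigO.trans_isLittleO (g := fun h : ℝ => h ^ 2) ?_
    (Asymptotics.isLittleO_pow_id one_lt_two)
  refine Asymptotics.IsBigO.of_bound (D * C ^ 2) ?_
  have hev : ∀ᶠ h : ℝ in 𝓝 0, |h| * C < 1 := by
    have : Continuous fun h : ℝ => |h| * C := by fun_prop
    exact this.continuousAt.eventually_lt continuousAt_const (by simp)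
  filter_upwards [hev] with h hh
  refine ContinuousLinearMap.opNorm_le_bound _ (by positivity) fun u => ?_
  set x : EuclideanSpace ℝ (Fin n) → ℝ := cutLap α k
  set e : EuclideanSpace ℝ (Fin n) → ℝ := fun ξ => Real.exp (-(t * x ξ)) with he
  have hx : BddMeas x := ⟨hm, C, hC⟩
  have heb : BddMeas e := ⟨hm', D, hD⟩
  have h1 : ((cutHeat n m α k (t + h)).restrictScalars ℝ - (cutHeat n m α k t).restrictScalars ℝ -
      h • (-((cutLapOp n m α k).comp (cutHeat n m α k t)).restrictScalars ℝ)) u =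
      mult m m (fun ξ => (Real.exp (-((t + h) * x ξ)) - e ξ) + h * (x ξ * e ξ)) u := by
    rw [mult_add ((bddMeas_cutHeatSymbol hα k (t + h)).sub heb)
      ((BddMeas.const h).mul (hx.mul heb)), mult_sub (bddMeas_cutHeatSymbol hα k (t + h)) heb,
      mult_const_mul (hx.mul heb), ← mult_mult (m' := m) hx heb]
    rw [smul_neg, sub_neg_eq_add]
    rfl
  rw [h1]
  refine norm_mult_apply_le ?_ (fun ξ => ?_) u
  · exact (((bddMeas_cutHeatSymbol hα k (t + h)).sub heb).add
      ((BddMeas.const h).mul (hx.mul heb))).1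
  · have h2 : Real.exp (-((t + h) * x ξ)) - e ξ + h * (x ξ * e ξ) =
        e ξ * (Real.exp (-(h * x ξ)) - 1 - (-(h * x ξ))) := by
      have : Real.exp (-((t + h) * x ξ)) = e ξ * Real.exp (-(h * x ξ)) := by
        rw [he, ← Real.exp_add]; congr 1; ring
      rw [this]; ring
    have h3 : |-(h * x ξ)| ≤ |h| * C := by
      rw [abs_neg, abs_mul]; exact mul_le_mul_of_nonneg_left (hC ξ) (abs_nonneg h)
    rw [h2, abs_mul, norm_pow, Real.norm_eq_abs, mul_assoc]
    refine mul_le_mul (hD ξ) ((Real.abs_exp_sub_one_sub_id_le (h3.trans hh.le)).trans ?_)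
      (abs_nonneg _) hD0
    rw [← sq_abs, ← mul_pow, mul_comm C]
    exact pow_le_pow_left₀ (abs_nonneg _) h3 2

theorem continuous_cutHeat (hα : 0 ≤ α) (k : ℕ) :
    Continuous fun t => (cutHeat n m α k t).restrictScalars ℝ :=
  continuous_iff_continuousAt.mpr fun t => (hasDerivAt_cutHeat hα k t).continuousAt

/-- Duhamel's formula. -/
def duhamel (α : ℝ) (a b : ℝ → ℝ) (f : ℝ → Sob n m) (u₀ : Sob n m) (t : ℝ) : Sob n m :=
  Real.exp (-∫ r in (0 : ℝ)..t, b r) • (heat n m α (∫ r in (0 : ℝ)..t, a r) u₀ +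
    ∫ s in (0 : ℝ)..t, Real.exp (∫ r in (0 : ℝ)..s, b r) •
      heat n m α ((∫ r in (0 : ℝ)..t, a r) - ∫ r in (0 : ℝ)..s, a r) (f s))

section Duhamel

variable {a b : ℝ → ℝ} {f : ℝ → Sob n m} {u₀ : Sob n m}

theorem continuous_duhamel_integrand (ha : Continuous a) (hb : Continuous b) (hf : Continuous f) :
    Continuous fun p : ℝ × ℝ => Real.exp (∫ r in (0 : ℝ)..p.2, b r) •
      heat n m α ((∫ r in (0 : ℝ)..p.1, a r) - ∫ r in (0 : ℝ)..p.2, a r) (f p.2) := by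
  have hA : Continuous fun t => ∫ r in (0 : ℝ)..t, a r :=
    intervalIntegral.continuous_primitive (fun _ _ => ha.intervalIntegrable _ _) 0
  have hB : Continuous fun t => ∫ r in (0 : ℝ)..t, b r :=
    intervalIntegral.continuous_primitive (fun _ _ => hb.intervalIntegrable _ _) 0
  refine (Real.continuous_exp.comp (hB.comp continuous_snd)).smul ?_
  exact ((hA.comp continuous_fst).sub (hA.comp continuous_snd)).sob_heat (hf.comp continuous_snd)

theorem continuous_duhamel (ha : Continuous a) (hb : Continuous b) (hf : Continuous f) :
    Continuous (duhamel α a b f u₀) := by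
  have hA : Continuous fun t => ∫ r in (0 : ℝ)..t, a r :=
    intervalIntegral.continuous_primitive (fun _ _ => ha.intervalIntegrable _ _) 0
  have hB : Continuous fun t => ∫ r in (0 : ℝ)..t, b r :=
    intervalIntegral.continuous_primitive (fun _ _ => hb.intervalIntegrable _ _) 0
  refine (Real.continuous_exp.comp hB.neg).smul (Continuous.add ?_ ?_)
  · exact hA.sob_heat continuous_const
  · exact intervalIntegral.continuous_parametric_intervalIntegral_of_continuous
      (f := fun t s => Real.exp (∫ r in (0 : ℝ)..s, b r) •
        heat n m α ((∫ r in (0 : ℝ)..t, a r) - ∫ r in (0 : ℝ)..s, a r) (f s))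
      (continuous_duhamel_integrand ha hb hf) continuous_id

theorem duhamel_zero : duhamel α a b f u₀ 0 = u₀ := by
  have h : heat n m α 0 u₀ = u₀ := by simpa [heat] using mult_one u₀
  simp [duhamel, h]

/-- After the cutoff the semigroup is a group, so the operator at time `A t - A s` factors as `S (A
t)` composed with `S (-A s)` and the first factor leaves the integral. What remains is a product of
differentiable functions of `t`. Nonnegativity of `a` keeps the times `A t - A s` nonnegative. -/
theorem cutOp_duhamel (hα : 0 ≤ α) (ha : Continuous a) (hb : Continuous b) (hf : Continuous f)
    (ha0 : ∀ t, 0 ≤ a t) (k : ℕ) {t : ℝ} (ht : 0 ≤ t) :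
    cutOp n m k (duhamel α a b f u₀ t) = Real.exp (-∫ r in (0 : ℝ)..t, b r) •
      (cutHeat n m α k (∫ r in (0 : ℝ)..t, a r)).restrictScalars ℝ (cutOp n m k u₀ +
        ∫ s in (0 : ℝ)..t, Real.exp (∫ r in (0 : ℝ)..s, b r) •
          (cutHeat n m α k (-∫ r in (0 : ℝ)..s, a r)).restrictScalars ℝ (cutOp n m k (f s))) := by
  have hA : Continuous fun t => ∫ r in (0 : ℝ)..t, a r :=
    intervalIntegral.continuous_primitive (fun _ _ => ha.intervalIntegrable _ _) 0
  have hB : Continuous fun t => ∫ r in (0 : ℝ)..t, b r :=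
    intervalIntegral.continuous_primitive (fun _ _ => hb.intervalIntegrable _ _) 0
  have hint : Continuous fun s => Real.exp (∫ r in (0 : ℝ)..s, b r) •
      heat n m α ((∫ r in (0 : ℝ)..t, a r) - ∫ r in (0 : ℝ)..s, a r) (f s) :=
    (Real.continuous_exp.comp hB).smul ((continuous_const.sub hA).sob_heat hf)
  have hint2 : Continuous fun s => Real.exp (∫ r in (0 : ℝ)..s, b r) •
      cutHeat n m α k (-∫ r in (0 : ℝ)..s, a r) (cutOp n m k (f s)) :=
    (Real.continuous_exp.comp hB).smul (((continuous_cutHeat hα k).comp hA.neg).clm_apply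
      ((cutOp n m k).continuous.comp hf))
  have e1 := cutOp_heat (m := m) hα k
    (intervalIntegral.integral_nonneg (μ := volume) ht fun s _ => ha0 s) u₀
  have e2 : cutOp n m k (∫ s in (0 : ℝ)..t, Real.exp (∫ r in (0 : ℝ)..s, b r) •
      heat n m α ((∫ r in (0 : ℝ)..t, a r) - ∫ r in (0 : ℝ)..s, a r) (f s)) =
      cutHeat n m α k (∫ r in (0 : ℝ)..t, a r) (∫ s in (0 : ℝ)..t,
        Real.exp (∫ r in (0 : ℝ)..s, b r) •
          cutHeat n m α k (-∫ r in (0 : ℝ)..s, a r) (cutOp n m k (f s))) := by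
    refine ((cutOp n m k).intervalIntegral_comp_comm (hint.intervalIntegrable _ _)).symm.trans
      (Eq.trans ?_ ((cutHeat n m α k (∫ r in (0 : ℝ)..t, a r)).intervalIntegral_comp_comm
        (hint2.intervalIntegrable _ _)))
    refine intervalIntegral.integral_congr fun s hs => ?_
    rw [uIcc_of_le ht] at hs
    have h1 : 0 ≤ (∫ r in (0 : ℝ)..t, a r) - ∫ r in (0 : ℝ)..s, a r := by
      rw [intervalIntegral.integral_interval_sub_left (ha.intervalIntegrable _ _)
        (ha.intervalIntegrable _ _)]
      exact intervalIntegral.integral_nonneg hs.2 fun s _ => ha0 s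
    refine (mult_real_smul _ _).trans (Eq.trans ?_ (mult_real_smul _ _).symm)
    refine congrArg _ ((cutOp_heat hα k h1 (f s)).trans ?_)
    rw [sub_eq_add_neg, ← cutHeat_add hα]
    rfl
  rw [duhamel, mult_real_smul, map_add, e1, e2, ← map_add]
  rfl

theorem isSolution_duhamel (hα : 0 ≤ α) {T : ℝ} (ha : Continuous a) (hb : Continuous b)
    (hf : Continuous f) (ha0 : ∀ t, 0 ≤ a t) :
    IsSolution hα T u₀ a b f (duhamel α a b f u₀) := by
  have huc := continuous_duhamel (α := α) (u₀ := u₀) ha hb hf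
  refine ⟨?_, duhamel_zero, fun t ht => ?_⟩
  · obtain ⟨C, hC⟩ := (isCompact_Icc (a := (0 : ℝ)) (b := T)).exists_bound_of_continuousOn
      huc.continuousOn
    exact MemLp.of_bound huc.aestronglyMeasurable C
      ((ae_restrict_iff' measurableSet_Icc).mpr (Eventually.of_forall hC))
  rw [equation_iff hα ((ha.smul huc).intervalIntegrable _ _)
    ((hb.smul huc).intervalIntegrable _ _) (hf.intervalIntegrable _ _)]
  intro k
  have hA : ∀ t, HasDerivAt (fun t => ∫ r in (0 : ℝ)..t, a r) (a t) t := fun t =>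
    (ha.integral_hasStrictDerivAt 0 t).hasDerivAt
  have hB : ∀ t, HasDerivAt (fun t => ∫ r in (0 : ℝ)..t, b r) (b t) t := fun t =>
    (hb.integral_hasStrictDerivAt 0 t).hasDerivAt
  set A : ℝ → ℝ := fun t => ∫ r in (0 : ℝ)..t, a r with hAdef
  set B : ℝ → ℝ := fun t => ∫ r in (0 : ℝ)..t, b r with hBdef
  have hAc : Continuous A := continuous_iff_continuousAt.mpr fun t => (hA t).continuousAt
  have hBc : Continuous B := continuous_iff_continuousAt.mpr fun t => (hB t).continuousAt
  set S : ℝ → (Sob n m →L[ℝ] Sob n m) := fun t => (cutHeat n m α k t).restrictScalars ℝ with hS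
  set g : ℝ → Sob n m := fun s => Real.exp (B s) • S (-A s) (cutOp n m k (f s)) with hg
  have hgc : Continuous g :=
    (Real.continuous_exp.comp hBc).smul (((continuous_cutHeat hα k).comp hAc.neg).clm_apply
      ((cutOp n m k).continuous.comp hf))
  set z : ℝ → Sob n m := fun t => cutOp n m k u₀ + ∫ s in (0 : ℝ)..t, g s with hz
  have hzd : ∀ t, HasDerivAt z (g t) t := fun t =>
    (hgc.integral_hasStrictDerivAt 0 t).hasDerivAt.const_add _
  set y : ℝ → Sob n m := fun t => Real.exp (-B t) • S (A t) (z t) with hy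
  -- The cut off Duhamel function solves an ordinary differential equation in `H^m` with a bounded
  -- operator; integrating it gives the required identity.
  have hyd : ∀ t, HasDerivAt y
      (-(a t • cutLapOp n m α k (y t)) - b t • y t + cutOp n m k (f t)) t := by
    intro t
    have h1 : HasDerivAt (fun t => S (A t)) _ t := (hasDerivAt_cutHeat hα k (A t)).scomp t (hA t)
    have h2 : HasDerivAt y _ t := (hB t).neg.exp.smul (h1.clm_apply (hzd t))
    rw [Pi.neg_apply] at h2
    refine h2.congr_deriv ?_
    have h3 : S (A t) (g t) = Real.exp (B t) • cutOp n m k (f t) := by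
      rw [hg, map_smul]
      congr 1
      change cutHeat n m α k (A t) (cutHeat n m α k (-A t) _) = _
      rw [cutHeat_add hα, add_neg_cancel, cutHeat_zero]
    have h4 : Real.exp (-B t) • Real.exp (B t) • cutOp n m k (f t) = cutOp n m k (f t) := by
      rw [smul_smul, ← Real.exp_add, neg_add_cancel, Real.exp_zero, one_smul]
    rw [h3, smul_add, h4]
    have h5 : (a t • -((cutLapOp n m α k).comp (cutHeat n m α k (A t))).restrictScalars ℝ) (z t) =
        -(a t • cutLapOp n m α k (S (A t) (z t))) := by
      rw [smul_neg]
      rfl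
    have h6 : cutLapOp n m α k (y t) = Real.exp (-B t) • cutLapOp n m α k (S (A t) (z t)) :=
      mult_real_smul _ _
    rw [h5, h6, hy]
    simp only [smul_neg, smul_smul, mul_neg, neg_smul]
    rw [mul_comm (Real.exp (-B t)) (a t), mul_comm (Real.exp (-B t)) (b t)]
    abel
  have hyc : Continuous y := continuous_iff_continuousAt.mpr fun t => (hyd t).continuousAt
  have hyu : ∀ s ∈ Icc 0 t, cutOp n m k (duhamel α a b f u₀ s) = y s := fun s hs =>
    cutOp_duhamel hα ha hb hf ha0 k hs.1
  have hI1 : ∫ s in (0 : ℝ)..t, a s • cutLapOp n m α k (duhamel α a b f u₀ s) =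
      ∫ s in (0 : ℝ)..t, a s • cutLapOp n m α k (y s) :=
    intervalIntegral.integral_congr fun s hs => by
      rw [uIcc_of_le ht.1] at hs
      simp only [← hyu s hs, cutLapOp_cutOp hα]
  have hI2 : ∫ s in (0 : ℝ)..t, b s • cutOp n m k (duhamel α a b f u₀ s) =
      ∫ s in (0 : ℝ)..t, b s • y s :=
    intervalIntegral.integral_congr fun s hs => by
      rw [uIcc_of_le ht.1] at hs
      simp only [← hyu s hs]
  have hc1 : Continuous fun s => a s • cutLapOp n m α k (y s) :=
    ha.smul ((cutLapOp n m α k).continuous.comp hyc)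
  have hc2 : Continuous fun s => b s • y s := hb.smul hyc
  have hc3 : Continuous fun s => cutOp n m k (f s) := (cutOp n m k).continuous.comp hf
  have hftc := intervalIntegral.integral_eq_sub_of_hasDerivAt (a := 0) (b := t)
    (fun s _ => hyd s) (((hc1.fun_neg.fun_sub hc2).fun_add hc3).intervalIntegrable _ _)
  rw [intervalIntegral.integral_add ((hc1.fun_neg.fun_sub hc2).intervalIntegrable _ _)
    (hc3.intervalIntegrable _ _), intervalIntegral.integral_sub (hc1.fun_neg.intervalIntegrable _ _)
    (hc2.intervalIntegrable _ _), intervalIntegral.integral_neg] at hftc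
  have hy0 : y 0 = cutOp n m k u₀ := by
    have h1 : B 0 = 0 := by simp [hBdef]
    have h2 : A 0 = 0 := by simp [hAdef]
    have h3 : z 0 = cutOp n m k u₀ := by simp [hz]
    have h4 : S 0 (cutOp n m k u₀) = cutOp n m k u₀ := cutHeat_zero k _
    simp only [hy]
    rw [h1, h2, h3, h4, neg_zero, Real.exp_zero, one_smul]
  rw [hI1, hI2, hyu t (right_mem_Icc.mpr ht.1), ← hy0]
  rw [eq_sub_iff_add_eq] at hftc
  rw [← hftc]
  abel

end Duhamel

end Sob

/-! ### Regularisation of distributions of compact support -/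

section Regularisation

variable {F : Type*} [NormedAddCommGroup F] [NormedSpace ℝ F]

/-- A distribution vanishes on test functions supported off its support. -/
theorem Distribution.apply_eq_zero_of_disjoint_dsupport {S : 𝓓'((⊤ : Opens ℝ), F)}
    {φ : 𝓓((⊤ : Opens ℝ), ℝ)} (h : tsupport φ ⊆ (Distribution.dsupport S)ᶜ) : S φ = 0 := by
  have hU : ∀ x ∈ tsupport φ, ∃ U : Set ℝ, Distribution.IsVanishingOn S U ∧ IsOpen U ∧ x ∈ U :=
    fun x hx => (Distribution.notMem_dsupport_iff x).mp (h hx)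
  choose! U hUv hUo hxU using hU
  obtain ⟨t, ht, hcov⟩ := φ.hasCompactSupport.elim_nhds_subcover U
    fun x hx => (hUo x hx).mem_nhds (hxU x hx)
  -- A partition of unity subordinate to a finite cover of the support splits `φ` into pieces, each
  -- supported where `S` vanishes.
  obtain ⟨ρ, hρ⟩ := SmoothPartitionOfUnity.exists_isSubordinate (modelWithCornersSelf ℝ ℝ)
    (isClosed_tsupport φ) (fun i : t => U i) (fun i => hUo i (ht i i.2))
    (by simpa [iUnion_subtype] using hcov)
  let g : t → 𝓓((⊤ : Opens ℝ), ℝ) := fun i =>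
    { toFun := fun x => ρ i x * φ x
      contDiff' := (ρ i).contMDiff.contDiff.mul φ.contDiff
      hasCompactSupport' := φ.hasCompactSupport.mul_left
      tsupport_subset' := by simp }
  have hg : φ = ∑ i, g i := by
    ext x
    have hsum : (∑ i, g i) x = ∑ i, ρ i x * φ x :=
      map_sum (Distribution.delta x : 𝓓'((⊤ : Opens ℝ), ℝ)) g Finset.univ
    rw [hsum, ← Finset.sum_mul]
    by_cases hx : x ∈ tsupport φ
    · have := ρ.sum_eq_one hx
      rw [finsum_eq_sum_of_fintype] at this
      rw [this, one_mul]
    · rw [image_eq_zero_of_notMem_tsupport hx, mul_zero]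
  rw [hg, map_sum]
  refine Finset.sum_eq_zero fun i _ => hUv i (ht i i.2) (g i) ?_
  exact (tsupport_mul_subset_left (f := ρ i) (g := φ)).trans (hρ i)

theorem exists_lipschitz_iteratedFDeriv {η : ℝ → ℝ}
    (hη : ContDiff ℝ (⊤ : ℕ∞) η) (hc : HasCompactSupport η) (i : ℕ) :
    ∃ L : ℝ, 0 ≤ L ∧ ∀ x y,
      ‖iteratedFDeriv ℝ i η x - iteratedFDeriv ℝ i η y‖ ≤ L * |x - y| := by
  have h1 : ContDiff ℝ 1 (iteratedFDeriv ℝ i η) := hη.iteratedFDeriv_right (by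
    exact_mod_cast le_top)
  obtain ⟨C, hC⟩ := ContDiff.lipschitzWith_of_hasCompactSupport (hc.iteratedFDeriv i) h1 one_ne_zero
  exact ⟨C, C.2, fun x y => by simpa [dist_eq_norm] using hC.dist_le_mul x y⟩

theorem TestFunction.exists_norm_le (ψ : 𝓓((⊤ : Opens ℝ), ℝ)) :
    ∃ r > 0, ∀ x, r < |x| → ψ x = 0 := by
  obtain ⟨r, hr, h⟩ := ψ.hasCompactSupport.isBounded.exists_pos_norm_le
  refine ⟨r, hr, fun x hx => image_eq_zero_of_notMem_tsupport fun hx' => ?_⟩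
  exact (h x hx').not_gt hx

theorem mollTest_apply (ψ : 𝓓((⊤ : Opens ℝ), ℝ)) (δ t s : ℝ) :
    mollTest ψ δ t s = δ⁻¹ * ψ ((t - s) / δ) := rfl

theorem mollTest_eq_zero {ψ : 𝓓((⊤ : Opens ℝ), ℝ)} {r δ t s : ℝ} (hr : ∀ x, r < |x| → ψ x = 0)
    (hδ : 0 < δ) (h : r * δ < |t - s|) : mollTest ψ δ t s = 0 := by
  rw [mollTest_apply, hr, mul_zero]
  rwa [abs_div, abs_of_pos hδ, lt_div_iff₀ hδ]

/-- `t ↦ ⟨S, ψ_δ(t - ·)⟩` is Lipschitz on bounded sets. -/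
theorem exists_lipschitz_apply_mollTest (S : 𝓓'((⊤ : Opens ℝ), F)) (ψ : 𝓓((⊤ : Opens ℝ), ℝ))
    {δ : ℝ} (hδ : 0 < δ) (R : ℝ) :
    ∃ L : ℝ, 0 ≤ L ∧ ∀ t ∈ Icc (-R) R, ∀ s ∈ Icc (-R) R,
      ‖S (mollTest ψ δ t) - S (mollTest ψ δ s)‖ ≤ L * |t - s| := by
  obtain ⟨r, hr, hψ⟩ := ψ.exists_norm_le
  -- One compact set containing the supports of all `ψ_δ(t - ·)` with `|t| ≤ R`. On test functions
  -- supported there, `S` is bounded by finitely many seminorms.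
  let K : Compacts ℝ := ⟨Icc (-(R + r * δ)) (R + r * δ), isCompact_Icc⟩
  have hzero : ∀ t ∈ Icc (-R) R, ∀ x ∉ (K : Set ℝ), mollTest ψ δ t x = 0 := by
    intro t ht x hx
    refine mollTest_eq_zero hψ hδ ?_
    by_contra! hcon
    refine hx ?_
    have := abs_le.mp hcon
    exact ⟨by linarith [ht.1], by linarith [ht.2]⟩
  let g : ∀ t ∈ Icc (-R) R, 𝓓^{⊤}_{K}(ℝ, ℝ) := fun t ht =>
    ⟨mollTest ψ δ t, (mollTest ψ δ t).contDiff, fun x hx => hzero t ht x hx⟩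
  have hK : (K : Set ℝ) ⊆ ((⊤ : Opens ℝ) : Set ℝ) := by simp
  let A : 𝓓^{⊤}_{K}(ℝ, ℝ) →L[ℝ] F := S.comp (TestFunction.ofSupportedInCLM ℝ hK)
  have hA : ∀ t ht, A (g t ht) = S (mollTest ψ δ t) := fun t ht => rfl
  obtain ⟨I, C, -, hC⟩ := Seminorm.bound_of_continuous
    (ContDiffMapSupportedIn.withSeminorms ℝ ℝ ℝ ⊤ K) ((normSeminorm ℝ F).comp A.toLinearMap)
    (continuous_norm.comp A.continuous)
  -- All these test functions are translates of `η`, so each seminorm of a difference is controlled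
  -- by a Lipschitz constant of a derivative of `η`.
  set η : ℝ → ℝ := fun y => δ⁻¹ * ψ (-y / δ) with hηdef
  have hη : ContDiff ℝ (⊤ : ℕ∞) η := contDiff_const.mul (ψ.contDiff.comp (by fun_prop))
  have hηc : HasCompactSupport η := by
    have := (mollTest ψ δ 0).hasCompactSupport
    have h2 : (mollTest ψ δ 0 : ℝ → ℝ) = η := by
      funext y
      rw [mollTest_apply, hηdef, zero_sub]
    rwa [h2] at this
  have hmη : ∀ t, (mollTest ψ δ t : ℝ → ℝ) = fun x => η (x - t) := fun t => by
    funext x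
    rw [mollTest_apply, hηdef]
    congr 2
    ring
  choose L hL0 hL using fun i => exists_lipschitz_iteratedFDeriv hη hηc i
  have hsemi : ∀ t ht s hs i, ContDiffMapSupportedIn.seminorm ℝ ℝ ℝ ⊤ K i (g t ht - g s hs) ≤
      L i * |t - s| := by
    intro t ht s hs i
    rw [ContDiffMapSupportedIn.seminorm_le_iff ℝ (mul_nonneg (hL0 i) (abs_nonneg _))]
    intro _ x _
    have h1 : (⇑(g t ht - g s hs) : ℝ → ℝ) =
        (fun x => η (x - t)) - fun x => η (x - s) := by
      rw [← hmη, ← hmη]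
      rfl
    have hsm : ∀ t, ContDiff ℝ (i : ℕ∞) fun x => η (x - t) := fun t =>
      (hη.comp (contDiff_id.sub contDiff_const)).of_le (by norm_cast)
    rw [h1, iteratedFDeriv_sub (by exact_mod_cast (hsm t)) (by exact_mod_cast (hsm s)),
      Pi.sub_apply, iteratedFDeriv_comp_sub, iteratedFDeriv_comp_sub]
    refine (hL i _ _).trans_eq ?_
    rw [show x - t - (x - s) = -(t - s) by ring, abs_neg]
  refine ⟨C * ∑ i ∈ I, L i, mul_nonneg C.2 (Finset.sum_nonneg fun i _ => hL0 i),
    fun t ht s hs => ?_⟩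
  rw [← hA t ht, ← hA s hs, ← map_sub]
  refine (hC (g t ht - g s hs)).trans ?_
  rw [smul_apply, NNReal.smul_def, smul_eq_mul, mul_assoc]
  refine mul_le_mul_of_nonneg_left ?_ C.2
  refine Seminorm.finset_sup_apply_le
    (mul_nonneg (Finset.sum_nonneg fun i _ => hL0 i) (abs_nonneg _)) fun i hi => ?_
  refine (hsemi t ht s hs i).trans ?_
  exact mul_le_mul_of_nonneg_right (Finset.single_le_sum (fun i _ => hL0 i) hi) (abs_nonneg _)

/-- The regularisation of a distribution of compact support is Lipschitz with compact support. -/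
theorem exists_lipschitzWith_apply_mollTest {S : 𝓓'((⊤ : Opens ℝ), F)} {T : ℝ}
    (hS : Distribution.dsupport S ⊆ Icc 0 T) (ψ : 𝓓((⊤ : Opens ℝ), ℝ)) {δ : ℝ} (hδ : 0 < δ) :
    (∃ L, LipschitzWith L fun t => S (mollTest ψ δ t)) ∧
      HasCompactSupport fun t => S (mollTest ψ δ t) := by
  obtain ⟨r, hr, hψ⟩ := ψ.exists_norm_le
  set R := |T| + r * δ + 1 with hR
  have hrδ : 0 < r * δ := mul_pos hr hδ
  have hR0 : 0 ≤ R := by positivity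
  -- The extra 1 makes `R` exceed `|T| + r * δ` strictly, so for such `t` the support of the test
  -- function misses `[0,T]`.
  have hzero : ∀ t, R ≤ |t| → S (mollTest ψ δ t) = 0 := by
    intro t ht
    refine Distribution.apply_eq_zero_of_disjoint_dsupport ?_
    refine Subset.trans ?_ (compl_subset_compl.mpr hS)
    have hsupp : tsupport (mollTest ψ δ t) ⊆ Icc (t - r * δ) (t + r * δ) := by
      refine closure_minimal (fun x hx => ?_) isClosed_Icc
      by_contra hcon
      refine hx (mollTest_eq_zero hψ hδ ?_)
      by_contra! hcon2
      have := abs_le.mp hcon2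
      exact hcon ⟨by linarith, by linarith⟩
    intro x hx hx2
    have hx := hsupp hx
    have h1 : |t| ≤ |T| + r * δ := by
      rw [abs_le]
      have := le_abs_self T
      have := abs_nonneg T
      exact ⟨by linarith [hx.2, hx2.1], by linarith [hx.1, hx2.2]⟩
    linarith
  refine ⟨?_, HasCompactSupport.of_support_subset_isCompact (isCompact_Icc (a := -R) (b := R))
    fun t ht => ?_⟩
  · obtain ⟨L, hL0, hL⟩ := exists_lipschitz_apply_mollTest S ψ hδ R
    -- Since the function vanishes where `|t| ≥ R`, projecting `t` onto `[-R,R]` does not change its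
    -- value, and the local Lipschitz bound becomes global.
    have hproj : ∀ t, S (mollTest ψ δ t) =
        S (mollTest ψ δ (projIcc (-R) R (by linarith) t : ℝ)) := by
      intro t
      rcases le_total t (-R) with h | h
      · rw [projIcc_of_le_left _ h, hzero t (by rw [abs_of_nonpos (by linarith)]; linarith),
          hzero]
        rw [abs_neg, abs_of_nonneg hR0]
      rcases le_total R t with h' | h'
      · rw [projIcc_of_right_le _ h', hzero t (by rw [abs_of_nonneg (by linarith)]; linarith),
          hzero]
        rw [abs_of_nonneg hR0]
      · rw [projIcc_of_mem _ ⟨h, h'⟩]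
    refine ⟨⟨L, hL0⟩, LipschitzWith.of_dist_le_mul fun t s => ?_⟩
    change dist (S (mollTest ψ δ t)) (S (mollTest ψ δ s)) ≤ _
    rw [hproj t, hproj s, dist_eq_norm]
    refine (hL _ (projIcc _ _ _ t).2 _ (projIcc _ _ _ s).2).trans ?_
    refine mul_le_mul_of_nonneg_left ?_ hL0
    exact abs_projIcc_sub_projIcc _
  · refine abs_le.mp ?_
    by_contra! hcon
    exact ht (hzero t hcon.le)

/-- A Lipschitz function has its almost everywhere derivative as weak derivative. -/
theorem isWeakDeriv_one_of_lipschitz {a : ℝ → ℝ} {L : NNReal} (ha : LipschitzWith L a) :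
    IsWeakDeriv 1 a (deriv a) := by
  have hd : MemLp (deriv a) ⊤ volume := memLp_top_of_bound (measurable_deriv a).aestronglyMeasurable
    L (Eventually.of_forall fun x => norm_deriv_le_of_lipschitz ha)
  refine ⟨ha.continuous.locallyIntegrable, hd.locallyIntegrable le_top, fun φ hφ hc => ?_⟩
  obtain ⟨D, hD⟩ := ContDiff.lipschitzWith_of_hasCompactSupport hc hφ (by simp)
  have h := ha.integral_lineDeriv_mul_eq (μ := volume) hD hc 1
  have h1 : ∀ g : ℝ → ℝ, ∀ x, lineDeriv ℝ g x 1 = deriv g x := fun g x => by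
    simp only [lineDeriv, smul_eq_mul, mul_one]
    rw [deriv_comp_const_add, add_zero]
  simp only [lineDeriv_neg, h1, neg_mul, integral_neg] at h
  rw [iteratedDeriv_one, pow_one, neg_one_mul, h, neg_neg]
  exact integral_congr_ae (Eventually.of_forall fun x => mul_comm _ _)

theorem isWeakDeriv_zero_self {a : ℝ → ℝ} (ha : LocallyIntegrable a) : IsWeakDeriv 0 a a :=
  ⟨ha, ha, fun φ _ _ => by simp⟩

/-- The fundamental lemma of the calculus of variations. It transfers the bounds on the zeroth
derivative in the definitions of moderate and negligible nets to the net itself. -/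
theorem IsWeakDeriv.ae_eq_of_zero {a g : ℝ → ℝ} (h : IsWeakDeriv 0 a g) : a =ᵐ[volume] g := by
  refine ae_eq_of_integral_contDiff_smul_eq h.1 h.2.1 fun φ hφ hc => ?_
  have := h.2.2 φ hφ hc
  rw [iteratedDeriv_zero, pow_zero, one_mul] at this
  simpa only [smul_eq_mul, mul_comm (φ _)] using this

theorem integral_mollTest (ψ : 𝓓((⊤ : Opens ℝ), ℝ)) {δ T : ℝ} (hδ : 0 < δ) (hT : 0 ≤ T) (t : ℝ) :
    ∫ s in Icc 0 T, mollTest ψ δ t s = ∫ x in (t - T) / δ..t / δ, ψ x := by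
  rw [integral_Icc_eq_integral_Ioc, ← intervalIntegral.integral_of_le hT]
  simp only [mollTest_apply, sub_div]
  rw [intervalIntegral.integral_const_mul, intervalIntegral.integral_comp_sub_div _ hδ.ne',
    zero_div, sub_zero, smul_eq_mul, ← mul_assoc, inv_mul_cancel₀ hδ.ne', one_mul]

theorem mollTest_nonneg {ψ : 𝓓((⊤ : Opens ℝ), ℝ)} (hψ : ∀ t, 0 ≤ ψ t) {δ : ℝ} (hδ : 0 < δ)
    (t s : ℝ) : 0 ≤ mollTest ψ δ t s :=
  mul_nonneg (inv_nonneg.mpr hδ.le) (hψ _)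

/-- For small `δ`, one of the halves of the mollifier is seen from every point of `[0,T]`. -/
theorem min_le_integral_mollTest {ψ : 𝓓((⊤ : Opens ℝ), ℝ)} (hψ : ∀ t, 0 ≤ ψ t) {r δ T t : ℝ}
    (hr : ∀ x, r < |x| → ψ x = 0) (hr0 : 0 < r) (hδ : 0 < δ) (hδT : 2 * (r * δ) ≤ T)
    (ht : t ∈ Icc 0 T) :
    min (∫ x in Iio 0, ψ x) (∫ x in Ioi 0, ψ x) ≤ ∫ s in Icc 0 T, mollTest ψ δ t s := by
  have hrδ : 0 < r * δ := mul_pos hr0 hδ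
  rw [integral_mollTest ψ hδ (by linarith) t]
  have hint : ∀ a b, IntervalIntegrable ψ volume a b := fun a b =>
    ψ.continuous.intervalIntegrable a b
  -- In the variable `(t - s) / δ` the domain is `[(t - T)/δ, t/δ]`. As `T/2 ≥ r * δ`, it contains
  -- `[0, r]` for `t ≥ T/2` and `[-r, 0]` for `t ≤ T/2`.
  rcases le_total (T / 2) t with h | h
  · refine (min_le_right _ _).trans ?_
    have h1 : ∫ x in Ioi 0, ψ x = ∫ x in (0 : ℝ)..r, ψ x := by
      rw [intervalIntegral.integral_of_le hr0.le]
      refine setIntegral_eq_of_subset_of_forall_sdiff_eq_zero measurableSet_Ioi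
        (fun x hx => hx.1) fun x hx => hr x ?_
      have h3 : 0 < x := hx.1
      by_contra! hcon
      rw [abs_of_pos h3] at hcon
      exact hx.2 ⟨h3, hcon⟩
    rw [h1]
    refine intervalIntegral.integral_mono_interval ?_ hr0.le ?_
      (Eventually.of_forall hψ) (hint _ _)
    · exact div_nonpos_of_nonpos_of_nonneg (by linarith [ht.2]) hδ.le
    · rw [le_div_iff₀ hδ]; linarith
  · refine (min_le_left _ _).trans ?_
    have h1 : ∫ x in Iio 0, ψ x = ∫ x in -r..0, ψ x := by
      rw [intervalIntegral.integral_of_le (by linarith), ← integral_Iic_eq_integral_Iio]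
      refine setIntegral_eq_of_subset_of_forall_sdiff_eq_zero measurableSet_Iic
        (fun x hx => hx.2) fun x hx => ?_
      have h3 : x ≤ 0 := hx.1
      rcases lt_or_ge r |x| with h4 | h4
      · exact hr x h4
      · rw [abs_of_nonpos h3] at h4
        -- The endpoint `-r` is excluded from the interval of integration and not covered by `hr`;
        -- there `ψ` vanishes by continuity from the left.
        have h5 : x = -r := by
          by_contra hne
          exact hx.2 ⟨lt_of_le_of_ne (by linarith) (Ne.symm hne), h3⟩
        rw [h5]
        have h6 : Tendsto ψ (𝓝[<] (-r)) (𝓝 (ψ (-r))) := ψ.continuous.continuousWithinAt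
        refine tendsto_nhds_unique h6 (tendsto_const_nhds.congr' ?_)
        filter_upwards [self_mem_nhdsWithin] with y hy
        have hy : y < -r := hy
        exact (hr y (by rw [abs_of_neg (by linarith)]; linarith)).symm
    rw [h1]
    refine intervalIntegral.integral_mono_interval ?_ (by linarith) ?_
      (Eventually.of_forall hψ) (hint _ _)
    · rw [div_le_iff₀ hδ]; linarith
    · exact div_nonneg ht.1 hδ.le

/-- A sequence of bounds can be run through slowly enough to grow at most logarithmically. -/
theorem exists_slow_index (M : ℕ → ℝ) :
    ∃ κ : ℝ → ℕ, Tendsto κ (𝓝[>] 0) atTop ∧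
      ∀ ε ∈ Ioc (0 : ℝ) 1, M (κ ε) ≤ |M 0| + Real.log (1 / ε) := by
  classical
  -- The largest admissible index below `1/ε`. The cap keeps the search finite, the index 0 is
  -- always admissible, and any fixed index becomes admissible as `ε → 0`.
  refine ⟨fun ε => Nat.findGreatest (fun k => M k ≤ |M 0| + Real.log (1 / ε)) ⌊1 / ε⌋₊, ?_,
    fun ε hε => ?_⟩
  · have hinv : Tendsto (fun ε : ℝ => 1 / ε) (𝓝[>] 0) atTop := by
      simpa using tendsto_inv_nhdsGT_zero (𝕜 := ℝ)
    refine tendsto_atTop.mpr fun K => ?_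
    have h1 := (tendsto_nat_floor_atTop.comp hinv).eventually_ge_atTop K
    have h2 := (Real.tendsto_log_atTop.comp hinv).eventually_ge_atTop (M K)
    filter_upwards [h1, h2] with ε h1 h2
    refine Nat.le_findGreatest h1 ?_
    have := abs_nonneg (M 0)
    simp only [Function.comp_apply] at h2
    linarith
  · refine Nat.findGreatest_spec (P := fun k => M k ≤ |M 0| + Real.log (1 / ε)) (Nat.zero_le _) ?_
    have h1 : 0 ≤ Real.log (1 / ε) := Real.log_nonneg (by rw [le_div_iff₀ hε.1]; linarith [hε.2])
    linarith [le_abs_self (M 0)]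

end Regularisation

/-! ### Stability of solutions and uniqueness -/

namespace Sob

variable {n : ℕ} {m α : ℝ} {σ : EuclideanSpace ℝ (Fin n) → ℝ}

attribute [local instance] innerProductSpace

/-- The real inner product underlying that of `H^m(ℝⁿ)`. -/
abbrev realInnerProductSpace : InnerProductSpace ℝ (Sob n m) := InnerProductSpace.complexToReal

attribute [local instance] realInnerProductSpace

theorem real_inner_mult_left (hσ : BddMeas σ) (u v : Sob n m) :
    inner ℝ (mult m m σ u) v = inner ℝ u (mult m m σ v) :=
  congrArg Complex.re (inner_mult_left hσ u v)

/-- The multiplier by `√σ` is self-adjoint with square the multiplier by `σ`, so the form is a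
squared norm. -/
theorem real_inner_mult_self_nonneg (hσ : BddMeas σ) (h0 : ∀ ξ, 0 ≤ σ ξ) (u : Sob n m) :
    0 ≤ inner ℝ u (mult m m σ u) := by
  have hs : BddMeas fun ξ => √(σ ξ) := by
    obtain ⟨hm, C, hC⟩ := hσ
    refine ⟨hm.sqrt, √C, fun ξ => ?_⟩
    rw [abs_of_nonneg (Real.sqrt_nonneg _)]
    exact Real.sqrt_le_sqrt ((le_abs_self _).trans (hC ξ))
  have h : mult m m σ u = mult m m (fun ξ => √(σ ξ)) (mult m m (fun ξ => √(σ ξ)) u) :=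
    (mult_mult_of_eq hs hs (fun ξ => Real.mul_self_sqrt (h0 ξ)) u).symm
  rw [h, ← real_inner_mult_left hs]
  exact real_inner_self_nonneg

/-- The symbol of the resolvent `(1 + Λ)⁻¹` of the cut off fractional Laplacian. -/
def cutResolvent (α : ℝ) (k : ℕ) {n : ℕ} (ξ : EuclideanSpace ℝ (Fin n)) : ℝ :=
  (1 + cutLap α k ξ)⁻¹

theorem cutResolvent_pos (α : ℝ) (k : ℕ) (ξ : EuclideanSpace ℝ (Fin n)) :
    0 < cutResolvent α k ξ :=
  inv_pos.mpr (by linarith [cutLap_nonneg α k ξ])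

theorem cutResolvent_le_one (α : ℝ) (k : ℕ) (ξ : EuclideanSpace ℝ (Fin n)) :
    cutResolvent α k ξ ≤ 1 :=
  inv_le_one_of_one_le₀ (by linarith [cutLap_nonneg α k ξ])

theorem bddMeas_cutResolvent (hα : 0 ≤ α) (k : ℕ) : BddMeas (cutResolvent α k (n := n)) :=
  ⟨((bddMeas_cutLap hα k).1.const_add 1).inv, 1, fun ξ => by
    rw [abs_of_pos (cutResolvent_pos α k ξ)]; exact cutResolvent_le_one α k ξ⟩

theorem sub_mult_cutResolvent (hα : 0 ≤ α) (k : ℕ) (u : Sob n m) :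
    u - mult m m (cutResolvent α k) u = mult m m (fun ξ => 1 - cutResolvent α k ξ) u := by
  rw [mult_sub (BddMeas.const 1) (bddMeas_cutResolvent hα k), mult_one]

/-- The relation `MΛ = 1 - M` behind the energy estimate. Both `M` and `1 - M` have symbols in
`[0,1]`, whence bounds independent of `k`. -/
theorem mult_cutResolvent_cutLapOp (hα : 0 ≤ α) (k : ℕ) (u : Sob n m) :
    mult m m (cutResolvent α k) (cutLapOp n m α k u) = u - mult m m (cutResolvent α k) u := by
  rw [sub_mult_cutResolvent hα]
  refine mult_mult_of_eq (bddMeas_cutResolvent hα k) (bddMeas_cutLap hα k) (fun ξ => ?_) u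
  have : 1 + cutLap α k ξ ≠ 0 := by linarith [cutLap_nonneg α k ξ]
  rw [cutResolvent]
  field_simp
  ring

theorem norm_sub_mult_cutResolvent_le (hα : 0 ≤ α) (k : ℕ) (u : Sob n m) :
    ‖u - mult m m (cutResolvent α k) u‖ ≤ ‖u‖ := by
  rw [sub_mult_cutResolvent hα, ← one_mul ‖u‖]
  refine norm_mult_apply_le ((BddMeas.const 1).sub (bddMeas_cutResolvent hα k)).1 (fun ξ => ?_) u
  have h1 := cutResolvent_pos α k ξ
  have h2 := cutResolvent_le_one α k ξ
  rw [abs_of_nonneg (by linarith)]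
  linarith

theorem norm_mult_cutResolvent_le (hα : 0 ≤ α) (k : ℕ) (u : Sob n m) :
    ‖mult m m (cutResolvent α k) u‖ ≤ ‖u‖ := by
  rw [← one_mul ‖u‖]
  refine norm_mult_apply_le (bddMeas_cutResolvent hα k).1 (fun ξ => ?_) u
  rw [abs_of_pos (cutResolvent_pos α k ξ)]
  exact cutResolvent_le_one α k ξ

end Sob

section Stability

attribute [local instance] Sob.innerProductSpace Sob.realInnerProductSpace

variable {n : ℕ} {m α T : ℝ} {a a' b b' : ℝ → ℝ} {f f' u v : ℝ → Sob n m} {u₀ v₀ : Sob n m}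

theorem intervalIntegrable_of_memLp {F : Type*} [NormedAddCommGroup F] {g : ℝ → F} {t : ℝ}
    (hg : MemLp g 2 (volume.restrict (Icc 0 T))) (ht : t ∈ Icc 0 T) :
    IntervalIntegrable g volume 0 t := by
  have h : IntegrableOn g (Icc 0 T) := hg.integrable (by norm_num)
  exact (intervalIntegrable_iff_integrableOn_Icc_of_le ht.1).mpr
    (h.mono_set (Icc_subset_Icc_right ht.2))

theorem MeasureTheory.MemLp.bdd_smul {μ : Measure ℝ} {g : ℝ → Sob n m}
    (ha : MemLp a ⊤ μ) (hg : MemLp g 2 μ) : MemLp (fun s => a s • g s) 2 μ :=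
  MemLp.smul (𝕜 := ℝ) (p := ⊤) (q := 2) (r := 2) hg ha

/-- Puts a solution in the form that the energy method requires: a primitive in `H^m` whose
integrand involves only bounded operators. -/
theorem IsSolution.cutoff_equation {hα : 0 ≤ α} (hu : IsSolution hα T u₀ a b f u)
    (ha : MemLp a ⊤ (volume.restrict (Icc 0 T))) (hb : MemLp b ⊤ (volume.restrict (Icc 0 T)))
    (hf : MemLp f 2 (volume.restrict (Icc 0 T))) (k : ℕ) {t : ℝ} (ht : t ∈ Icc 0 T) :
    Sob.cutOp n m k (u t) = Sob.cutOp n m k u₀ + ∫ s in (0 : ℝ)..t,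
      (-(a s • Sob.cutLapOp n m α k (u s)) - b s • Sob.cutOp n m k (u s)
        + Sob.cutOp n m k (f s)) := by
  have h := (Sob.equation_iff hα (intervalIntegrable_of_memLp (ha.bdd_smul hu.memLp) ht)
    (intervalIntegrable_of_memLp (hb.bdd_smul hu.memLp) ht)
    (intervalIntegrable_of_memLp hf ht)).mp (hu.equation t ht) k
  have h1 : IntervalIntegrable (fun s => -(a s • Sob.cutLapOp n m α k (u s))) volume 0 t :=
    (intervalIntegrable_of_memLp (ha.bdd_smul ((Sob.cutLapOp n m α k).comp_memLp' hu.memLp)) ht).neg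
  have h2 : IntervalIntegrable (fun s => b s • Sob.cutOp n m k (u s)) volume 0 t :=
    intervalIntegrable_of_memLp (hb.bdd_smul ((Sob.cutOp n m k).comp_memLp' hu.memLp)) ht
  have h3 : IntervalIntegrable (fun s => Sob.cutOp n m k (f s)) volume 0 t :=
    intervalIntegrable_of_memLp ((Sob.cutOp n m k).comp_memLp' hf) ht
  rw [intervalIntegral.integral_add (h1.sub h2) h3, intervalIntegral.integral_sub h1 h2,
    intervalIntegral.integral_neg]
  rw [← eq_sub_iff_add_eq, ← eq_sub_iff_add_eq] at h
  rw [h]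
  abel

/-- Comparing a solution with this one turns the stability estimate into an a priori bound. -/
theorem isSolution_zero (hα : 0 ≤ α) (T : ℝ) (a b : ℝ → ℝ) :
    IsSolution hα T (0 : Sob n m) a b (fun _ => 0) (fun _ => 0) := by
  refine ⟨MemLp.zero', rfl, fun t _ => ?_⟩
  simp [Sob.fracLap_eq_mult]

/-- It suffices to bound the cut off functions in `L²([0,T]; H^m)`. -/
theorem integral_norm_sq_le_of_cutOp {w : ℝ → Sob n m} {R : ℝ} (hT : 0 ≤ T)
    (hw : MemLp w 2 (volume.restrict (Icc 0 T)))
    (h : ∀ k : ℕ, ∫ s in (0 : ℝ)..T, ‖Sob.cutOp n m k (w s)‖ ^ 2 ≤ R) :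
    ∫ s in (0 : ℝ)..T, ‖w s‖ ^ 2 ≤ R := by
  have hint : IntegrableOn (fun s => ‖w s‖ ^ 2) (Icc 0 T) := hw.integrable_norm_pow (by simp)
  have hm (k : ℕ) : AEStronglyMeasurable (fun s => Sob.cutOp n m k (w s))
      (volume.restrict (Icc 0 T)) := ((Sob.cutOp n m k).comp_memLp' hw).1
  simp only [intervalIntegral.integral_of_le hT, ← integral_Icc_eq_integral_Ioc] at h ⊢
  refine le_of_tendsto' (x := atTop)
    (f := fun k : ℕ => ∫ s in Icc 0 T, ‖Sob.cutOp n m k (w s)‖ ^ 2) ?_ h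
  refine tendsto_integral_of_dominated_convergence (fun s => ‖w s‖ ^ 2)
    (fun k => (hm k).norm.pow 2) hint
    (fun k => Eventually.of_forall fun s => ?_) (Eventually.of_forall fun s => ?_)
  · rw [norm_pow, norm_norm]
    exact pow_le_pow_left₀ (norm_nonneg _) (Sob.norm_cutOp_le k _) 2
  · have ht : Tendsto (fun k : ℕ => Sob.cutOp n m k (w s)) atTop (𝓝 (w s)) :=
      Sob.tendsto_cutOp (w s)
    exact ht.norm.pow 2

set_option maxHeartbeats 800000 in
-- The equation for `v` is rewritten with the coefficients of `u`. The defect in `b` goes into `p`;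
-- the defect in `a` is kept under `Λ` as `q = -(a - a') v`, so only the `H^m` norm of `v` enters
-- and the bound does not depend on `k`.
theorem IsSolution.integral_norm_cutOp_sub_sq_le {hα : 0 ≤ α} (hT : 0 ≤ T)
    (hu : IsSolution hα T u₀ a b f u) (hv : IsSolution hα T v₀ a' b' f' v)
    (ha : MemLp a ⊤ (volume.restrict (Icc 0 T))) (hb : MemLp b ⊤ (volume.restrict (Icc 0 T)))
    (hf : MemLp f 2 (volume.restrict (Icc 0 T)))
    (ha' : MemLp a' ⊤ (volume.restrict (Icc 0 T))) (hb' : MemLp b' ⊤ (volume.restrict (Icc 0 T)))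
    (hf' : MemLp f' 2 (volume.restrict (Icc 0 T)))
    {c c₀ β d : ℝ} (hc₀ : 0 < c₀) (hcc₀ : c₀ ≤ c) (hc₀' : c₀ ≤ 1) (hβ : 0 ≤ β)
    (hac : ∀ᵐ s ∂volume.restrict (Icc 0 T), c ≤ a s)
    (hbβ : ∀ᵐ s ∂volume.restrict (Icc 0 T), |b s| ≤ β)
    (had : ∀ᵐ s ∂volume.restrict (Icc 0 T), |a s - a' s| ≤ d)
    (hbd : ∀ᵐ s ∂volume.restrict (Icc 0 T), |b s - b' s| ≤ d) (k : ℕ) :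
    ∫ s in (0 : ℝ)..T, ‖Sob.cutOp n m k (u s - v s)‖ ^ 2 ≤
      c₀⁻¹ * ((‖u₀ - v₀‖ ^ 2 + c₀⁻¹ * (2 * (∫ s in (0 : ℝ)..T, ‖f s - f' s‖ ^ 2)
        + 8 * d ^ 2 * ∫ s in (0 : ℝ)..T, ‖v s‖ ^ 2)) * Real.exp ((2 + 2 * β) * T)) := by
  have huv := hu.memLp.sub hv.memLp
  have hff := hf.sub hf'
  have hint1 : IntegrableOn (fun s => ‖f s - f' s‖ ^ 2) (Icc 0 T) := hff.integrable_norm_pow (by simp)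
  have hint2 : IntegrableOn (fun s => ‖v s‖ ^ 2) (Icc 0 T) := hv.memLp.integrable_norm_pow (by simp)
  have hint3 : IntegrableOn (fun s => ‖u s - v s‖ ^ 2) (Icc 0 T) :=
    huv.integrable_norm_pow (by simp)
  -- Here `‖p‖ + ‖q‖ ≤ ‖f - f'‖ + 2d‖v‖`, as each coefficient defect contributes `d‖v‖`; then `(x +
  -- y)² ≤ 2x² + 2y²` gives the factors 2 and 8.
  set g : ℝ → ℝ := fun s => 2 * ‖f s - f' s‖ ^ 2 + 8 * d ^ 2 * ‖v s‖ ^ 2 with hg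
  have hgint : ∫ s in (0 : ℝ)..T, g s = 2 * (∫ s in (0 : ℝ)..T, ‖f s - f' s‖ ^ 2)
        + 8 * d ^ 2 * ∫ s in (0 : ℝ)..T, ‖v s‖ ^ 2 := by
    rw [hg, intervalIntegral.integral_add, intervalIntegral.integral_const_mul,
      intervalIntegral.integral_const_mul]
    · exact ((intervalIntegrable_iff_integrableOn_Icc_of_le hT).mpr hint1).const_mul 2
    · exact ((intervalIntegrable_iff_integrableOn_Icc_of_le hT).mpr hint2).const_mul _
  rw [← hgint]
  set Q := Sob.cutOp n m k with hQ
  set Λ := Sob.cutLapOp n m α k with hΛ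
  have hmem : ∀ {a b : ℝ → ℝ} {u f : ℝ → Sob n m}, MemLp a ⊤ (volume.restrict (Icc 0 T)) →
      MemLp b ⊤ (volume.restrict (Icc 0 T)) → MemLp u 2 (volume.restrict (Icc 0 T)) →
      MemLp f 2 (volume.restrict (Icc 0 T)) →
      MemLp (fun s => -(a s • Λ (u s)) - b s • Q (u s) + Q (f s)) 2
        (volume.restrict (Icc 0 T)) := fun ha hb hu hf =>
    ((ha.bdd_smul (Λ.comp_memLp' hu)).neg.sub (hb.bdd_smul (Q.comp_memLp' hu))).add
      (Q.comp_memLp' hf)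
  have hmu := hmem ha hb hu.memLp hf
  have hmv := hmem ha' hb' hv.memLp hf'
  have hY : ∀ t ∈ Icc 0 T, Q (u t - v t) = Q (u₀ - v₀) + ∫ s in (0 : ℝ)..t,
      ((-(a s • Λ (u s)) - b s • Q (u s) + Q (f s)) -
        (-(a' s • Λ (v s)) - b' s • Q (v s) + Q (f' s))) := by
    intro t ht
    rw [intervalIntegral.integral_sub (intervalIntegrable_of_memLp hmu ht)
      (intervalIntegrable_of_memLp hmv ht), map_sub, map_sub,
      hu.cutoff_equation ha hb hf k ht, hv.cutoff_equation ha' hb' hf' k ht]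
    abel
  have key := energy_estimate (H := Sob n m)
    ((Sob.mult m m (Sob.cutResolvent α k)).restrictScalars ℝ) (Λ.restrictScalars ℝ)
    (Sob.real_inner_mult_left (Sob.bddMeas_cutResolvent hα k))
    (Sob.real_inner_mult_self_nonneg (Sob.bddMeas_cutResolvent hα k)
      fun ξ => (Sob.cutResolvent_pos α k ξ).le)
    (Sob.norm_mult_cutResolvent_le hα k) (Sob.mult_cutResolvent_cutLapOp hα k)
    (Sob.norm_sub_mult_cutResolvent_le hα k) hT hc₀ hcc₀ hc₀' hβ
    (g := g) (p := fun s => Q (f s - f' s) - (b s - b' s) • Q (v s))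
    (q := fun s => -((a s - a' s) • v s))
    ((hmu.sub hmv).integrable (by norm_num)) hY
    (Eventually.of_forall fun s => by
      have e1 : Λ (Q (u s - v s)) = Λ (u s) - Λ (v s) := by
        rw [hΛ, hQ, Sob.cutLapOp_cutOp hα, map_sub]
      have e2 : Λ (-((a s - a' s) • v s)) = -((a s - a' s) • Λ (v s)) := by
        rw [map_neg, hΛ, Sob.mult_real_smul]
      simp only [ContinuousLinearMap.coe_restrictScalars', Pi.sub_apply]
      rw [e1, e2, map_sub, map_sub]
      module) hac hbβ
    (by
      filter_upwards [had, hbd] with s h1 h2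
      have e1 : ‖Q (f s - f' s) - (b s - b' s) • Q (v s)‖ ≤ ‖f s - f' s‖ + d * ‖v s‖ := by
        refine (norm_sub_le _ _).trans (add_le_add (Sob.norm_cutOp_le k _) ?_)
        rw [norm_smul, Real.norm_eq_abs]
        exact mul_le_mul h2 (Sob.norm_cutOp_le k _) (norm_nonneg _) ((abs_nonneg _).trans h2)
      have e2 : ‖-((a s - a' s) • v s)‖ ≤ d * ‖v s‖ := by
        rw [norm_neg, norm_smul, Real.norm_eq_abs]
        exact mul_le_mul_of_nonneg_right h1 (norm_nonneg _)
      calc _ ≤ (‖f s - f' s‖ + 2 * (d * ‖v s‖)) ^ 2 := by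
            refine pow_le_pow_left₀ (by positivity) ?_ 2
            linarith
        _ ≤ g s := by
            simp only [hg]
            nlinarith [sq_nonneg (‖f s - f' s‖ - 2 * (d * ‖v s‖))])
    ((hint1.const_mul 2).add (hint2.const_mul (8 * d ^ 2)))
  refine key.trans ?_
  have : ‖Q (u₀ - v₀)‖ ≤ ‖u₀ - v₀‖ := Sob.norm_cutOp_le k _
  gcongr

/-- Continuous dependence of the solution on all the data in `L²([0,T]; H^m)`. -/
theorem IsSolution.integral_norm_sub_sq_le {hα : 0 ≤ α} (hT : 0 ≤ T)
    (hu : IsSolution hα T u₀ a b f u) (hv : IsSolution hα T v₀ a' b' f' v)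
    (ha : MemLp a ⊤ (volume.restrict (Icc 0 T))) (hb : MemLp b ⊤ (volume.restrict (Icc 0 T)))
    (hf : MemLp f 2 (volume.restrict (Icc 0 T)))
    (ha' : MemLp a' ⊤ (volume.restrict (Icc 0 T))) (hb' : MemLp b' ⊤ (volume.restrict (Icc 0 T)))
    (hf' : MemLp f' 2 (volume.restrict (Icc 0 T)))
    {c c₀ β d : ℝ} (hc₀ : 0 < c₀) (hcc₀ : c₀ ≤ c) (hc₀' : c₀ ≤ 1) (hβ : 0 ≤ β)
    (hac : ∀ᵐ s ∂volume.restrict (Icc 0 T), c ≤ a s)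
    (hbβ : ∀ᵐ s ∂volume.restrict (Icc 0 T), |b s| ≤ β)
    (had : ∀ᵐ s ∂volume.restrict (Icc 0 T), |a s - a' s| ≤ d)
    (hbd : ∀ᵐ s ∂volume.restrict (Icc 0 T), |b s - b' s| ≤ d) :
    ∫ s in (0 : ℝ)..T, ‖u s - v s‖ ^ 2 ≤
      c₀⁻¹ * ((‖u₀ - v₀‖ ^ 2 + c₀⁻¹ * (2 * (∫ s in (0 : ℝ)..T, ‖f s - f' s‖ ^ 2)
        + 8 * d ^ 2 * ∫ s in (0 : ℝ)..T, ‖v s‖ ^ 2)) * Real.exp ((2 + 2 * β) * T)) :=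
  integral_norm_sq_le_of_cutOp hT (hu.memLp.sub hv.memLp) fun k =>
    hu.integral_norm_cutOp_sub_sq_le hT hv ha hb hf ha' hb' hf' hc₀ hcc₀ hc₀' hβ hac hbβ had hbd k

end Stability

/-! ### Moderateness of solutions and uniqueness for nets. -/

section Nets

variable {T : ℝ}

theorem eLpNorm_le_ofReal_iff {F : Type*} [NormedAddCommGroup F] {g : ℝ → F} (hT : 0 ≤ T)
    (hg : MemLp g 2 (volume.restrict (Icc 0 T))) {C : ℝ} (hC : 0 ≤ C) :
    eLpNorm g 2 (volume.restrict (Icc 0 T)) ≤ ENNReal.ofReal C ↔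
      ∫ s in (0 : ℝ)..T, ‖g s‖ ^ 2 ≤ C ^ 2 := by
  rw [hg.eLpNorm_eq_integral_rpow_norm (by norm_num) (by norm_num),
    ENNReal.ofReal_le_ofReal_iff hC, intervalIntegral.integral_of_le hT,
    ← integral_Icc_eq_integral_Ioc, ENNReal.toReal_ofNat, ← one_div, ← Real.sqrt_eq_rpow,
    Real.sqrt_le_left hC]
  simp only [Real.rpow_ofNat]

theorem LinfModerate.memLp_top {k : ℕ} {a : ℝ → ℝ → ℝ} (ha : LinfModerate k a) {ε : ℝ}
    (hε : ε ∈ Ioc (0 : ℝ) 1) (s : Set ℝ) : MemLp (a ε) ⊤ (volume.restrict s) := by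
  obtain ⟨D, hD, -⟩ := ha
  obtain ⟨h1, h2⟩ := hD ε hε 0 (Nat.zero_le _)
  exact (h1.ae_eq h2.ae_eq_of_zero.symm).restrict s

theorem LinfNegligible.exists_bound {k : ℕ} {a : ℝ → ℝ → ℝ} (ha : LinfNegligible k a)
    (T : ℝ) (q : ℕ) : ∃ c > (0 : ℝ), ∀ ε ∈ Ioc (0 : ℝ) 1,
      ∀ᵐ t ∂volume.restrict (Icc 0 T), |a ε t| ≤ c * ε ^ q := by
  obtain ⟨D, hD, h⟩ := ha
  obtain ⟨c, hc, h⟩ := h (Icc 0 T) isCompact_Icc q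
  refine ⟨c, hc, fun ε hε => ?_⟩
  filter_upwards [h ε hε 0 (Nat.zero_le _),
    ae_restrict_of_ae (hD ε hε 0 (Nat.zero_le _)).2.ae_eq_of_zero] with t h1 h2
  rwa [h2]

/-- The Gronwall factor of a log-bounded net is moderate. -/
theorem exp_log_le {C T ε : ℝ} (hε : ε ∈ Ioc (0 : ℝ) 1) :
    Real.exp ((2 + 2 * (C * (1 + Real.log (1 / ε)))) * T) ≤
      Real.exp ((2 + 2 * C) * T) * (ε ^ ⌈2 * C * T⌉₊)⁻¹ := by
  have h1 : (2 + 2 * (C * (1 + Real.log (1 / ε)))) * T =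
      (2 + 2 * C) * T + 2 * C * T * Real.log (1 / ε) := by ring
  rw [h1, Real.exp_add]
  refine mul_le_mul_of_nonneg_left ?_ (Real.exp_pos _).le
  have h2 : 0 ≤ Real.log (1 / ε) := Real.log_nonneg (by rw [le_div_iff₀ hε.1]; linarith [hε.2])
  -- The left side is `ε ^ (-2CT)`; rounding the exponent up to a natural number is harmless because
  -- `log (1/ε) ≥ 0`.
  calc Real.exp (2 * C * T * Real.log (1 / ε))
      ≤ Real.exp (⌈2 * C * T⌉₊ * Real.log (1 / ε)) := by
        gcongr
        exact Nat.le_ceil _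
    _ = (ε ^ ⌈2 * C * T⌉₊)⁻¹ := by
        rw [Real.exp_nat_mul, Real.exp_log (by have := hε.1; positivity), one_div, inv_pow]

theorem LogBounded.exists_nonneg {b : ℝ → ℝ → ℝ} (hb : LogBounded T b) :
    ∃ C : ℝ, 0 ≤ C ∧ ∀ ε ∈ Ioc (0 : ℝ) 1, ∀ᵐ t ∂volume.restrict (Icc 0 T),
      |b ε t| ≤ C * (1 + Real.log (1 / ε)) := by
  obtain ⟨C, hC⟩ := hb
  refine ⟨|C|, abs_nonneg C, fun ε hε => ?_⟩
  have h2 : 0 ≤ Real.log (1 / ε) := Real.log_nonneg (by rw [le_div_iff₀ hε.1]; linarith [hε.2])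
  filter_upwards [hC ε hε] with t ht
  exact ht.trans (mul_le_mul_of_nonneg_right (le_abs_self C) (by positivity))

variable {n : ℕ} {m α : ℝ} {u₀ : Sob n m}

/-- Solutions for moderate data are moderate. -/
theorem exists_integral_norm_sq_le {hα : 0 ≤ α} (hT : 0 ≤ T) {a b : ℝ → ℝ → ℝ}
    {f u : ℝ → ℝ → Sob n m} (ha : LinfModerate 1 a) (hap : UniformlyPositive T a)
    (hb : LinfModerate 0 b) (hbl : LogBounded T b) (hf : L2Moderate T f)
    (hu : ∀ ε ∈ Ioc (0 : ℝ) 1, IsSolution hα T u₀ (a ε) (b ε) (f ε) (u ε)) :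
    ∃ K : ℝ, 0 ≤ K ∧ ∃ N : ℕ, ∀ ε ∈ Ioc (0 : ℝ) 1,
      ∫ s in (0 : ℝ)..T, ‖u ε s‖ ^ 2 ≤ K * (ε ^ N)⁻¹ := by
  obtain ⟨c, hc, hac⟩ := hap
  obtain ⟨C, hC, hbC⟩ := hbl.exists_nonneg
  obtain ⟨hf2, N, cf, hcf, hfN⟩ := hf
  set c₀ := min c 1 with hc₀def
  have hc₀ : 0 < c₀ := lt_min hc one_pos
  set P := ⌈2 * C * T⌉₊
  refine ⟨c₀⁻¹ * ((‖u₀‖ ^ 2 + c₀⁻¹ * (2 * cf ^ 2)) * Real.exp ((2 + 2 * C) * T)), by positivity,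
    P + 2 * N, fun ε hε => ?_⟩
  have hε0 := hε.1
  have hlog : 0 ≤ Real.log (1 / ε) := Real.log_nonneg (by rw [le_div_iff₀ hε.1]; linarith [hε.2])
  -- Comparison with the zero solution for the same coefficients, hence `d = 0`. The Gronwall factor
  -- costs `ε ^ P` and the squared norm of the source costs `ε ^ (2N)`.
  have h := IsSolution.integral_norm_sub_sq_le hT (hu ε hε) (isSolution_zero hα T (a ε) (b ε))
    (ha.memLp_top hε _) (hb.memLp_top hε _) (hf2 ε hε) (ha.memLp_top hε _) (hb.memLp_top hε _)
    MemLp.zero' (β := C * (1 + Real.log (1 / ε))) (d := 0) hc₀ (min_le_left _ _) (min_le_right _ _)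
    (by positivity) (hac ε hε) (hbC ε hε) (by simp) (by simp)
  simp only [sub_zero] at h
  have hfε := (eLpNorm_le_ofReal_iff hT (hf2 ε hε) (by positivity)).mp (hfN ε hε)
  have hexp := exp_log_le (C := C) (T := T) hε
  refine h.trans ?_
  have hX : 1 ≤ ((ε ^ N)⁻¹) ^ 2 :=
    one_le_pow₀ (one_le_inv_iff₀.mpr ⟨by positivity, pow_le_one₀ hε0.le hε.2⟩)
  calc _ ≤ c₀⁻¹ * ((‖u₀‖ ^ 2 * ((ε ^ N)⁻¹) ^ 2 + c₀⁻¹ * (2 * (cf * (ε ^ N)⁻¹) ^ 2 + 0)) *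
        (Real.exp ((2 + 2 * C) * T) * (ε ^ P)⁻¹)) := by
        gcongr
        · exact le_mul_of_one_le_right (by positivity) hX
        · simp
    _ = _ := by
        rw [pow_add, pow_mul', mul_inv, inv_pow]
        ring

/-- The energy estimate uses the positivity and log-bound of `a` and `b` only. Those of `a'` and
`b'` serve to make `u'` moderate, since its norm multiplies the negligible coefficient defects. -/
theorem veryWeakUnique (hα : 0 ≤ α) (hT : 0 ≤ T) (u₀ : Sob n m) : VeryWeakUnique hα T u₀ := by
  intro a a' b b' f f' u u' ha ha' hd hap hap' hb hb' hbd hbl hbl' hf hf' hfd hu hu'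
  obtain ⟨K, hK, N, hKN⟩ := exists_integral_norm_sq_le hT ha' hap' hb' hbl' hf' hu'
  obtain ⟨c, hc, hac⟩ := hap
  obtain ⟨C, hC, hbC⟩ := hbl.exists_nonneg
  set c₀ := min c 1 with hc₀def
  have hc₀ : 0 < c₀ := lt_min hc one_pos
  set P := ⌈2 * C * T⌉₊
  have hmem : ∀ ε ∈ Ioc (0 : ℝ) 1,
      MemLp (fun t => u ε t - u' ε t) 2 (volume.restrict (Icc 0 T)) :=
    fun ε hε => (hu ε hε).memLp.sub (hu' ε hε).memLp
  refine ⟨hmem, fun q => ?_⟩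
  -- The surplus `P` pays for the Gronwall factor; for the coefficients, `N` pays in addition for
  -- the size of `u'`.
  obtain ⟨cf, hcf, hfq⟩ := hfd.2 (q + P)
  obtain ⟨ca, hca, haq⟩ := hd.exists_bound T (q + P + N)
  obtain ⟨cb, hcb, hbq⟩ := hbd.exists_bound T (q + P + N)
  set A := c₀⁻¹ * (c₀⁻¹ * (2 * cf ^ 2 + 8 * (ca + cb) ^ 2 * K) * Real.exp ((2 + 2 * C) * T))
    with hA
  have hA0 : 0 < A := by positivity
  refine ⟨√A, Real.sqrt_pos.mpr hA0, fun ε hε => ?_⟩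
  have hε0 := hε.1
  rw [eLpNorm_le_ofReal_iff hT (hmem ε hε) (by positivity)]
  have hlog : 0 ≤ Real.log (1 / ε) := Real.log_nonneg (by rw [le_div_iff₀ hε.1]; linarith [hε.2])
  have h := IsSolution.integral_norm_sub_sq_le hT (hu ε hε) (hu' ε hε)
    (ha.memLp_top hε _) (hb.memLp_top hε _) (hf.1 ε hε) (ha'.memLp_top hε _) (hb'.memLp_top hε _)
    (hf'.1 ε hε) (β := C * (1 + Real.log (1 / ε))) (d := (ca + cb) * ε ^ (q + P + N)) hc₀
    (min_le_left _ _) (min_le_right _ _) (by positivity) (hac ε hε) (hbC ε hε)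
    (by
      filter_upwards [haq ε hε] with t ht
      refine ht.trans ?_
      gcongr
      linarith)
    (by
      filter_upwards [hbq ε hε] with t ht
      refine ht.trans ?_
      gcongr
      linarith)
  refine h.trans ?_
  have hfε := (eLpNorm_le_ofReal_iff hT (hfd.1 ε hε) (by positivity)).mp (hfq ε hε)
  have hexp := exp_log_le (C := C) (T := T) hε
  have hX0 : 0 < ε ^ P := by positivity
  have hX1 : ε ^ P ≤ 1 := pow_le_one₀ hε0.le hε.2
  have hZ0 : 0 < ε ^ N := by positivity
  have hZ1 : ε ^ N ≤ 1 := pow_le_one₀ hε0.le hε.2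
  rw [sub_self, norm_zero, zero_pow two_ne_zero, zero_add]
  calc _ ≤ c₀⁻¹ * (c₀⁻¹ * (2 * (cf * ε ^ (q + P)) ^ 2 +
          8 * ((ca + cb) * ε ^ (q + P + N)) ^ 2 * (K * (ε ^ N)⁻¹)) *
          (Real.exp ((2 + 2 * C) * T) * (ε ^ P)⁻¹)) := by
        gcongr
        exact hKN ε hε
    _ = c₀⁻¹ * (c₀⁻¹ * (2 * cf ^ 2 * ε ^ P + 8 * (ca + cb) ^ 2 * K * (ε ^ P * ε ^ N)) *
          Real.exp ((2 + 2 * C) * T)) * (ε ^ q) ^ 2 := by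
        rw [pow_add ε (q + P) N, pow_add ε q P]
        field_simp
    _ ≤ c₀⁻¹ * (c₀⁻¹ * (2 * cf ^ 2 * 1 + 8 * (ca + cb) ^ 2 * K * (1 * 1)) *
          Real.exp ((2 + 2 * C) * T)) * (ε ^ q) ^ 2 := by
        gcongr
    _ = (√A * ε ^ q) ^ 2 := by
        rw [mul_pow, Real.sq_sqrt hA0.le, hA]
        ring

end Nets

/-! ### Existence by a slowly varying scale. -/

section Existence

theorem one_add_log_le_inv {ε : ℝ} (hε : 0 < ε) : 1 + Real.log (1 / ε) ≤ ε⁻¹ := by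
  have := Real.log_le_sub_one_of_pos (x := 1 / ε) (by positivity)
  rw [one_div] at this ⊢
  linarith

theorem LinfModerate.zero_of_bound {a : ℝ → ℝ → ℝ} {A : ℝ} (hA : 0 < A)
    (hc : ∀ ε ∈ Ioc (0 : ℝ) 1, Continuous (a ε))
    (h : ∀ ε ∈ Ioc (0 : ℝ) 1, ∀ t, |a ε t| ≤ A * ε⁻¹) : LinfModerate 0 a := by
  refine ⟨fun _ => a, fun ε hε k hk => ?_, fun K _ => ⟨1, A, hA, fun ε hε k hk => ?_⟩⟩
  · obtain rfl : k = 0 := Nat.le_zero.mp hk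
    exact ⟨memLp_top_of_bound (hc ε hε).aestronglyMeasurable _ (Eventually.of_forall (h ε hε)),
      isWeakDeriv_zero_self (hc ε hε).locallyIntegrable⟩
  · obtain rfl : k = 0 := Nat.le_zero.mp hk
    simpa using Eventually.of_forall (h ε hε)

theorem LinfModerate.one_of_lipschitz {a : ℝ → ℝ → ℝ} {A : ℝ} (hA : 0 < A) {L : ℝ → NNReal}
    (hL : ∀ ε ∈ Ioc (0 : ℝ) 1, LipschitzWith (L ε) (a ε))
    (hLA : ∀ ε ∈ Ioc (0 : ℝ) 1, L ε ≤ A * ε⁻¹)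
    (h : ∀ ε ∈ Ioc (0 : ℝ) 1, ∀ t, |a ε t| ≤ A * ε⁻¹) : LinfModerate 1 a := by
  refine ⟨fun k ε => if k = 0 then a ε else deriv (a ε), fun ε hε k hk => ?_,
    fun K _ => ⟨1, A, hA, fun ε hε k hk => ?_⟩⟩
  · interval_cases k
    · exact ⟨memLp_top_of_bound (hL ε hε).continuous.aestronglyMeasurable _
        (Eventually.of_forall (h ε hε)),
        isWeakDeriv_zero_self (hL ε hε).continuous.locallyIntegrable⟩
    · exact ⟨memLp_top_of_bound (measurable_deriv (a ε)).aestronglyMeasurable _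
        (Eventually.of_forall fun t => norm_deriv_le_of_lipschitz (hL ε hε)),
        isWeakDeriv_one_of_lipschitz (hL ε hε)⟩
  · have hε0 := hε.1
    interval_cases k
    · simpa using Eventually.of_forall (h ε hε)
    · refine Eventually.of_forall fun t => ?_
      have h1 : |deriv (a ε) t| ≤ L ε := norm_deriv_le_of_lipschitz (hL ε hε)
      refine (h1.trans (hLA ε hε)).trans ?_
      refine mul_le_mul_of_nonneg_left ?_ hA.le
      -- With `N = 1` the derivative may grow like `ε ^ (-2)`, so the bound by `ε⁻¹` is more than
      -- enough.
      rw [inv_le_inv₀ hε0 (by positivity)]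
      exact pow_le_of_le_one hε0.le hε.2 two_ne_zero

theorem L2Moderate.of_toReal_le {F : Type*} [NormedAddCommGroup F] {T A : ℝ} (hA : 0 < A)
    {g : ℝ → ℝ → F} (hg : ∀ ε ∈ Ioc (0 : ℝ) 1, MemLp (g ε) 2 (volume.restrict (Icc 0 T)))
    (h : ∀ ε ∈ Ioc (0 : ℝ) 1,
      (eLpNorm (g ε) 2 (volume.restrict (Icc 0 T))).toReal ≤ A * ε⁻¹) : L2Moderate T g := by
  refine ⟨hg, 1, A, hA, fun ε hε => ?_⟩
  rw [pow_one]
  exact (ENNReal.le_ofReal_iff_toReal_le (hg ε hε).2.ne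
    (mul_nonneg hA.le (inv_nonneg.mpr hε.1.le))).mpr (h ε hε)

theorem Continuous.memLp_two_restrict_Icc {F : Type*} [NormedAddCommGroup F] [NormedSpace ℝ F]
    {g : ℝ → F} (hg : Continuous g) (T : ℝ) : MemLp g 2 (volume.restrict (Icc 0 T)) := by
  obtain ⟨C, hC⟩ := (isCompact_Icc (a := (0 : ℝ)) (b := T)).exists_bound_of_continuousOn
    hg.continuousOn
  exact MemLp.of_bound hg.aestronglyMeasurable C
    ((ae_restrict_iff' measurableSet_Icc).mpr (Eventually.of_forall hC))

variable {n : ℕ} {m α T : ℝ}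

/-- Each width gives a solvable problem with finite constants, so moderateness only requires that
the width decrease slowly with `ε`. -/
theorem exists_veryWeakSolution (hα : 0 < α) (hT : 0 < T)
    {a b : 𝓓'((⊤ : Opens ℝ), ℝ)} {f : 𝓓'((⊤ : Opens ℝ), Sob n m)} (u₀ : Sob n m)
    (ha : Distribution.dsupport a ⊆ Icc 0 T) (hb : Distribution.dsupport b ⊆ Icc 0 T)
    (hf : Distribution.dsupport f ⊆ Icc 0 T) {a₀ : ℝ} (ha₀ : 0 < a₀)
    (hpos : ∀ φ : 𝓓((⊤ : Opens ℝ), ℝ), (∀ t, 0 ≤ φ t) → a₀ * (∫ t in Icc 0 T, φ t) ≤ a φ)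
    {ψ : 𝓓((⊤ : Opens ℝ), ℝ)} (hψ : ∀ t, 0 ≤ ψ t) :
    ∃ ω : ℝ → ℝ, IsScale ω ∧
      ((0 < ∫ t in Iio 0, ψ t) → (0 < ∫ t in Ioi 0, ψ t) →
        UniformlyPositive T (regularise a ψ ω)) ∧
      LogBounded T (regularise b ψ ω) ∧
      ∃ u : ℝ → ℝ → Sob n m,
        IsVeryWeakSolution hα.le T u₀ (regularise a ψ ω) (regularise b ψ ω)
          (regularise f ψ ω) u ∧
        ∀ ε ∈ Ioc (0 : ℝ) 1, ContinuousOn (u ε) (Icc 0 T) := by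
  obtain ⟨r, hr0, hr⟩ := ψ.exists_norm_le
  -- The factor `T / (2r)` ensures that `2 r δ ≤ T` from the first term on, as the lower bound for
  -- the mollified `a` requires.
  set δ : ℕ → ℝ := fun k => T / (2 * r) * (1 / ((k : ℝ) + 1)) with hδdef
  have hδ (k : ℕ) : 0 < δ k := by positivity
  have hδT (k : ℕ) : 2 * (r * δ k) ≤ T := by
    have h1 : 2 * (r * δ k) = T * (1 / ((k : ℝ) + 1)) := by
      simp only [hδdef]; field_simp
    rw [h1]
    refine mul_le_of_le_one_right hT.le ?_
    rw [div_le_one (by positivity)]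
    linarith [k.cast_nonneg (α := ℝ)]
  have hδ0 : Tendsto δ atTop (𝓝 0) := by
    simpa [hδdef] using
      (tendsto_one_div_add_atTop_nhds_zero_nat (𝕜 := ℝ)).const_mul (T / (2 * r))
  have hac (k : ℕ) := exists_lipschitzWith_apply_mollTest ha ψ (hδ k)
  have hbc (k : ℕ) := exists_lipschitzWith_apply_mollTest hb ψ (hδ k)
  have hfc (k : ℕ) := exists_lipschitzWith_apply_mollTest hf ψ (hδ k)
  choose L hL using fun k => (hac k).1
  have hac' (k : ℕ) : Continuous fun t => a (mollTest ψ (δ k) t) := (hL k).continuous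
  have hbc' (k : ℕ) : Continuous fun t => b (mollTest ψ (δ k) t) := (hbc k).1.choose_spec.continuous
  have hfc' (k : ℕ) : Continuous fun t => f (mollTest ψ (δ k) t) := (hfc k).1.choose_spec.continuous
  choose A hA using fun k => (hac' k).bounded_above_of_compact_support (hac k).2
  choose B hB using fun k => (hbc' k).bounded_above_of_compact_support (hbc k).2
  have ha0 (k : ℕ) (t : ℝ) : a₀ * (∫ s in Icc 0 T, mollTest ψ (δ k) t s) ≤
      a (mollTest ψ (δ k) t) := hpos _ (mollTest_nonneg hψ (hδ k) t)
  -- Nonnegativity suffices for Duhamel's formula and holds for every mollifier; a uniform lower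
  -- bound needs mass on both sides of the origin.
  have ha0' (k : ℕ) (t : ℝ) : 0 ≤ a (mollTest ψ (δ k) t) :=
    (mul_nonneg ha₀.le (integral_nonneg (mollTest_nonneg hψ (hδ k) t))).trans (ha0 k t)
  set U : ℕ → ℝ → Sob n m := fun k => Sob.duhamel α (fun t => a (mollTest ψ (δ k) t))
    (fun t => b (mollTest ψ (δ k) t)) (fun t => f (mollTest ψ (δ k) t)) u₀ with hU
  have hUc (k : ℕ) : Continuous (U k) := Sob.continuous_duhamel (hac' k) (hbc' k) (hfc' k)
  have hUs (k : ℕ) : IsSolution hα.le T u₀ (fun t => a (mollTest ψ (δ k) t))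
      (fun t => b (mollTest ψ (δ k) t)) (fun t => f (mollTest ψ (δ k) t)) (U k) :=
    Sob.isSolution_duhamel hα.le (hac' k) (hbc' k) (hfc' k) (ha0' k)
  set F : ℕ → ℝ := fun k => (eLpNorm (fun t => f (mollTest ψ (δ k) t)) 2
    (volume.restrict (Icc 0 T))).toReal with hF
  set V : ℕ → ℝ := fun k => (eLpNorm (U k) 2 (volume.restrict (Icc 0 T))).toReal with hV
  -- The maximum includes `V k`, the norm of the solution itself, so the slow index makes the
  -- solutions moderate together with the data. The same bound on `B k` makes the net for `b`
  -- log-bounded.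
  obtain ⟨κ, hκ, hM⟩ := exists_slow_index fun k => max (max (L k) (max (A k) (B k))) (max (F k) (V k))
  set c := |max (max (L 0 : ℝ) (max (A 0) (B 0))) (max (F 0) (V 0))| + 1 with hc
  have hc0 : 0 < c := by positivity
  have hMc : ∀ ε ∈ Ioc (0 : ℝ) 1, max (max (L (κ ε) : ℝ) (max (A (κ ε)) (B (κ ε))))
      (max (F (κ ε)) (V (κ ε))) ≤ c * (1 + Real.log (1 / ε)) := by
    intro ε hε
    have h0 : 0 ≤ Real.log (1 / ε) :=
      Real.log_nonneg (by rw [le_div_iff₀ hε.1]; linarith [hε.2])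
    refine (hM ε hε).trans ?_
    rw [hc]
    nlinarith [abs_nonneg (max (max (L 0 : ℝ) (max (A 0) (B 0))) (max (F 0) (V 0)))]
  simp only [max_le_iff] at hMc
  have hinv : ∀ ε ∈ Ioc (0 : ℝ) 1, c * (1 + Real.log (1 / ε)) ≤ c * ε⁻¹ := fun ε hε =>
    mul_le_mul_of_nonneg_left (one_add_log_le_inv hε.1) hc0.le
  refine ⟨fun ε => δ (κ ε), ⟨fun ε _ => hδ _, hδ0.comp hκ⟩, fun h1 h2 => ?_, ?_,
    fun ε => U (κ ε), ⟨?_, ?_, ?_, fun ε _ => hUs (κ ε), ?_⟩, fun ε _ => (hUc (κ ε)).continuousOn⟩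
  · refine ⟨a₀ * min (∫ t in Iio 0, ψ t) (∫ t in Ioi 0, ψ t), mul_pos ha₀ (lt_min h1 h2),
      fun ε _ => (ae_restrict_iff' measurableSet_Icc).mpr (Eventually.of_forall fun t ht => ?_)⟩
    exact (mul_le_mul_of_nonneg_left
      (min_le_integral_mollTest hψ hr hr0 (hδ _) (hδT _) ht) ha₀.le).trans (ha0 (κ ε) t)
  · exact ⟨c, fun ε hε => Eventually.of_forall fun t =>
      (hB (κ ε) t).trans (hMc ε hε).1.2.2⟩
  · exact LinfModerate.one_of_lipschitz hc0 (L := fun ε => L (κ ε)) (fun ε _ => hL (κ ε))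
      (fun ε hε => (hMc ε hε).1.1.trans (hinv ε hε))
      fun ε hε t => (hA (κ ε) t).trans ((hMc ε hε).1.2.1.trans (hinv ε hε))
  · exact LinfModerate.zero_of_bound hc0 (fun ε _ => hbc' (κ ε))
      fun ε hε t => (hB (κ ε) t).trans ((hMc ε hε).1.2.2.trans (hinv ε hε))
  · exact L2Moderate.of_toReal_le hc0 (fun ε _ => (hfc' (κ ε)).memLp_two_restrict_Icc T)
      fun ε hε => (hMc ε hε).2.1.trans (hinv ε hε)
  · exact L2Moderate.of_toReal_le hc0 (fun ε _ => (hUc (κ ε)).memLp_two_restrict_Icc T)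
      fun ε hε => (hMc ε hε).2.2.trans (hinv ε hε)

end Existence

end

theorem theorem1p2 (n : ℕ) (α : ℝ) (hα : 0 < α) (m : ℝ) (T : ℝ) (hT : 0 < T)
    (a b : 𝓓'((⊤ : Opens ℝ), ℝ)) (f : 𝓓'((⊤ : Opens ℝ), Sob n m)) (u₀ : Sob n m)
    (ha : Distribution.dsupport a ⊆ Icc 0 T) (hb : Distribution.dsupport b ⊆ Icc 0 T)
    (hf : Distribution.dsupport f ⊆ Icc 0 T)
    (a₀ : ℝ) (ha₀ : 0 < a₀)
    (hpos : ∀ φ : 𝓓((⊤ : Opens ℝ), ℝ), (∀ t, 0 ≤ φ t) → a₀ * (∫ t in Icc 0 T, φ t) ≤ a φ) :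
    (∀ ψ : 𝓓((⊤ : Opens ℝ), ℝ), IsMollifier ψ →
      ∃ ω : ℝ → ℝ, IsScale ω ∧
        ((0 < ∫ t in Iio 0, ψ t) → (0 < ∫ t in Ioi 0, ψ t) →
          UniformlyPositive T (regularise a ψ ω)) ∧
        LogBounded T (regularise b ψ ω) ∧
        ∃ u : ℝ → ℝ → Sob n m,
          IsVeryWeakSolution hα.le T u₀ (regularise a ψ ω) (regularise b ψ ω)
            (regularise f ψ ω) u ∧
          ∀ ε ∈ Ioc (0 : ℝ) 1, ContinuousOn (u ε) (Icc 0 T)) ∧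
    VeryWeakUnique hα.le T u₀ :=
  ⟨fun _ hψ => exists_veryWeakSolution hα hT u₀ ha hb hf ha₀ hpos hψ.1,
    veryWeakUnique hα.le hT.le u₀⟩
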